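/- Let $n\ge 2$. Let $S_n$ be the symmetric group on $\{1,\dots,n\}$ and let $B_n=S_n\ltimes\mathbb{Z}_2^n$ be the group of signed permutations $w=w_1\cdots w_n$ (words whose entries are $1,\dots,n$ in some order, some of them barred, i.e. negated). It is generated by the elementary transpositions $s_i=(i,i+1)$, $1\le i\le n-1$, and $s_0=\bar1 2\cdots n$. Let $D_n\subseteq B_n$ be the subgroup of signed permutations with an even number of signs (bars), generated by $s_1,\dots,s_{n-1}$ and $s_{1'}=\bar2\bar1 3\cdots n$. The generators are identified with the index sets $\{0,1,\dots,n-1\}$ in type $B$ and $\{1',1,\dots,n-1\}$ in type $D$. For $W=B_n$ or $W=D_n$ with these generators, let $\ell(w)$ be the least length of an expression of $w$ as a product of generators, and let $\mathrm{Des}(w)=\{i : \ell(ws_i)<\ell(w)\}$. For a set $J$ of indices put, in the group algebra $\mathbb{Q}W$, \[Y_J=\sum_{\mathrm{Des}(w)=J}w,\qquad X_J=\sum_{I\subseteq J}Y_I .\] Let $\Sigma(W)$ be the linear span of all the $Y_J$; it is a unital subalgebra of $\mathbb{Q}W$, Solomon's descent algebra. Define $\chi:B_n\to D_n$ by $\chi(w)=w$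 if $w\in D_n$ and $\chi(w)=ws_0$ if $w\notin D_n$ (that is, flip the sign of the first entry when the number of signs is odd). Let $\varphi:B_n\to S_n$ be the morphism that forgets the signs, and let $\psi:D_n\to S_n$ be its restriction. Denote the linear extensions of these maps to the rational group algebras by the same letters. **Proposition.** The linear map $\chi$ restricts to a morphism of (unital) algebras $\chi:\Sigma(B_n)\to\Sigma(D_n)$. Explicitly, for every $J\subseteq\{2,\dots,n-1\}$, \[\chi(Y_J)=Y_J,\qquad \chi(Y_{\{1\}\cup J})=Y_{\{1'\}\cup J}+Y_{\{1\}\cup J}+Y_{\{1',1\}\cup J},\] \[\chi(Y_{\{0\}\cup J})=Y_J+Y_{\{1'\}\cup J}+Y_{\{1\}\cup J},\qquad \chi(Y_{\{0,1\}\cup J})=Y_{\{1',1\}\cup J},\] and \[\chi(X_J)=X_J,\qquad \chi(X_{\{1\}\cup J})=X_{\{1',1\}\cup J},\] \[\chi(X_{\{0\}\cup J})=X_{\{1'\}\cup J}+X_{\{1\}\cup J},\qquad \chi(X_{\{0,1\}\cup J})=2\,X_{\{1',1\}\cup J}.\] Moreover $\varphi=\psi\chi$, both as maps $B_n\to S_n$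 and as maps $\mathbb{Q}B_n\to\mathbb{Q}S_n$ (in particular on $\Sigma(B_n)$). -/

import Mathlib

noncomputable section

/-! ### Descent algebras of a finite group with a finite family of generators -/

/-- `ℓ(w)`: the least length of an expression of `w` as a product of the generators `s i`. -/
def wordLength {W ι : Type*} [Group W] (s : ι → W) (w : W) : ℕ :=
  sInf {k : ℕ | ∃ l : List ι, l.length = k ∧ (l.map s).prod = w}

open Classical in
/-- `Des(w) = {i | ℓ(w s_i) < ℓ(w)}`. -/
def desSet {W ι : Type*} [Group W] [Fintype ι] (s : ι → W) (w : W) : Finset ι :=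
  {i : ι | wordLength s (w * s i) < wordLength s w}

open Classical in
/-- `Y_J`: the sum in the rational group algebra of all `w` with `Des(w) = J`. -/
def basisY {W ι : Type*} [Group W] [Fintype W] [Fintype ι] (s : ι → W) (J : Finset ι) :
    MonoidAlgebra ℚ W :=
  ∑ w : W with desSet s w = J, MonoidAlgebra.of ℚ W w

open Classical in
/-- `X_J`: the sum of all `Y_I` with `I ⊆ J`. -/
def basisX {W ι : Type*} [Group W] [Fintype W] [Fintype ι] (s : ι → W) (J : Finset ι) :
    MonoidAlgebra ℚ W :=
  ∑ I ∈ J.powerset, basisY s I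

/-- The linear span of the `Y_J`, the underlying space of Solomon's descent algebra. -/
def descentSpan {W ι : Type*} [Group W] [Fintype W] [Fintype ι] (s : ι → W) :
    Submodule ℚ (MonoidAlgebra ℚ W) :=
  Submodule.span ℚ (Set.range (basisY s))

/-! ### Signed permutations -/

/-- The group `B_n = S_n ⋉ Z_2^n` of signed permutations of `n` letters. The element
`w = ⟨ε, σ⟩` is the word `w_1 … w_n` with underlying permutation `σ`, in which the letter `v` is
barred iff `ε v = -1`; the entry in position `i` is thus `ε (σ i) · σ i`. -/
abbrev SignedPerm (n : ℕ) : Type :=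
  (Fin n → ℤˣ) ⋊[(mulAutArrow : Equiv.Perm (Fin n) →* MulAut (Fin n → ℤˣ))] Equiv.Perm (Fin n)

instance signedPermFintype (n : ℕ) : Fintype (SignedPerm n) :=
  Fintype.ofEquiv ((Fin n → ℤˣ) × Equiv.Perm (Fin n)) SemidirectProduct.equivProd.symm

/-- The number of signs (bars) of a signed permutation. -/
def numSigns {n : ℕ} (w : SignedPerm n) : ℕ :=
  (Finset.univ.filter fun v : Fin n => w.left v = -1).card

theorem even_numSigns_iff {n : ℕ} (w : SignedPerm n) :
    Even (numSigns w) ↔ ∏ v, w.left v = 1 := by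
  have h : ∏ v, w.left v = (-1 : ℤˣ) ^ numSigns w := by
    have h1 : ∀ v, w.left v = if w.left v = -1 then (-1 : ℤˣ) else 1 := by
      intro v
      rcases Int.units_eq_one_or (w.left v) with h | h <;> simp [h]
    rw [Finset.prod_congr rfl fun v _ => h1 v, Finset.prod_ite]
    simp [numSigns]
  rw [h]
  rcases Nat.even_or_odd (numSigns w) with he | ho
  · simp [he]
  · simp [ho.neg_one_pow, Nat.not_even_iff_odd.mpr ho]

theorem prod_left_mul {n : ℕ} (u w : SignedPerm n) :
    ∏ v, (u * w).left v = (∏ v, u.left v) * ∏ v, w.left v := by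
  have h : ∀ v, (u * w).left v = u.left v * w.left (u.right⁻¹ v) := fun v => rfl
  rw [Finset.prod_congr rfl fun v _ => h v, Finset.prod_mul_distrib,
    Equiv.prod_comp u.right⁻¹ w.left]

/-- The subgroup `D_n` of `B_n`: signed permutations with an even number of signs. -/
def evenSigned (n : ℕ) : Subgroup (SignedPerm n) where
  carrier := {w | Even (numSigns w)}
  mul_mem' {a b} ha hb := by
    rw [Set.mem_setOf_eq, even_numSigns_iff] at *
    rw [prod_left_mul, ha, hb, one_mul]
  one_mem' := by
    rw [Set.mem_setOf_eq, even_numSigns_iff]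
    simp
  inv_mem' {a} ha := by
    rw [Set.mem_setOf_eq, even_numSigns_iff] at *
    have h := prod_left_mul a a⁻¹
    rw [mul_inv_cancel, ha, one_mul] at h
    rw [← h]
    simp

open Classical in
instance evenSignedFintype (n : ℕ) : Fintype (evenSigned n) :=
  Subtype.fintype fun w => w ∈ evenSigned n

/-- The elementary transposition `s_i = (i, i+1)` for `i = 1, …, n-1`, without signs
(positions in `Fin n` are numbered from `0`). -/
def elemTransp {n : ℕ} (i : Fin n) : SignedPerm n :=
  ⟨1, Equiv.swap ⟨i.val - 1, by omega⟩ i⟩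

/-- The signed permutation `s_0 = \bar 1 2 … n`. -/
def signFlip {n : ℕ} (hn : 2 ≤ n) : SignedPerm n :=
  ⟨Pi.mulSingle ⟨0, by omega⟩ (-1), 1⟩

/-- The signed permutation `s_{1'} = \bar 2 \bar 1 3 … n`. -/
def signSwap {n : ℕ} (hn : 2 ≤ n) : SignedPerm n :=
  ⟨Pi.mulSingle ⟨0, by omega⟩ (-1) * Pi.mulSingle ⟨1, by omega⟩ (-1),
    Equiv.swap ⟨0, by omega⟩ ⟨1, by omega⟩⟩

/-- The generators of `B_n`: the index `0` stands for `s_0`, and `i = 1, …, n-1` for `s_i`. -/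
def genB {n : ℕ} (hn : 2 ≤ n) (i : Fin n) : SignedPerm n :=
  if i.val = 0 then signFlip hn else elemTransp i

theorem prod_left_signFlip {n : ℕ} (hn : 2 ≤ n) : ∏ v, (signFlip hn).left v = -1 := by
  simp [signFlip]

theorem signSwap_mem {n : ℕ} (hn : 2 ≤ n) : signSwap hn ∈ evenSigned n := by
  change Even _
  rw [even_numSigns_iff]
  simp [signSwap, Finset.prod_mul_distrib]

theorem elemTransp_mem {n : ℕ} (i : Fin n) : elemTransp i ∈ evenSigned n := by
  change Even _
  rw [even_numSigns_iff]
  simp [elemTransp]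

/-- The generators of `D_n`: the index `0` stands for `s_{1'}`, and `i = 1, …, n-1` for `s_i`. -/
def genD {n : ℕ} (hn : 2 ≤ n) (i : Fin n) : evenSigned n :=
  if i.val = 0 then ⟨signSwap hn, signSwap_mem hn⟩ else ⟨elemTransp i, elemTransp_mem i⟩

/-! ### The maps between the groups and their linear extensions -/

theorem mul_signFlip_mem {n : ℕ} (hn : 2 ≤ n) {w : SignedPerm n} (hw : w ∉ evenSigned n) :
    w * signFlip hn ∈ evenSigned n := by
  change ¬ Even _ at hw
  change Even _
  rw [even_numSigns_iff] at *
  rw [prod_left_mul, prod_left_signFlip, (Int.units_eq_one_or _).resolve_left hw]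
  simp

open Classical in
/-- `χ : B_n → D_n`, `χ(w) = w` if `w ∈ D_n` and `χ(w) = w s_0` otherwise. -/
def chi {n : ℕ} (hn : 2 ≤ n) (w : SignedPerm n) : evenSigned n :=
  if hw : w ∈ evenSigned n then ⟨w, hw⟩ else ⟨w * signFlip hn, mul_signFlip_mem hn hw⟩

/-- The linear extension of `χ` to the rational group algebras. -/
def chiLin {n : ℕ} (hn : 2 ≤ n) :
    MonoidAlgebra ℚ (SignedPerm n) →ₗ[ℚ] MonoidAlgebra ℚ (evenSigned n) :=
  MonoidAlgebra.mapDomainLinearMap ℚ ℚ (chi hn)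

/-- `φ : B_n → S_n` forgets the signs. -/
def phi (n : ℕ) : SignedPerm n →* Equiv.Perm (Fin n) := SemidirectProduct.rightHom

/-- `ψ : D_n → S_n` is the restriction of `φ`. -/
def psi (n : ℕ) : evenSigned n →* Equiv.Perm (Fin n) := (phi n).comp (evenSigned n).subtype

/-- The linear extension of `φ` to the rational group algebras. -/
def phiLin (n : ℕ) :
    MonoidAlgebra ℚ (SignedPerm n) →ₐ[ℚ] MonoidAlgebra ℚ (Equiv.Perm (Fin n)) :=
  MonoidAlgebra.mapDomainAlgHom ℚ ℚ (phi n)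

/-- The linear extension of `ψ` to the rational group algebras. -/
def psiLin (n : ℕ) :
    MonoidAlgebra ℚ (evenSigned n) →ₐ[ℚ] MonoidAlgebra ℚ (Equiv.Perm (Fin n)) :=
  MonoidAlgebra.mapDomainAlgHom ℚ ℚ (psi n)

end

/-! Two facts are needed: each descent span is an algebra (Solomon), and `χ`, which is not a
homomorphism on the group, becomes one on the descent algebra of type B.

For Solomon's theorem, let W act on tuples over an ordered abelian group. A tuple x has a unique
standardization `std x` = u: x·u is dominant, and ties on walls are broken by requiring no descent
of u there. Equivalently, u makes the lexicographic pair (x, ρ) strictly dominant. The sum of `std`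
over all translates of a dominant x is the order of its stabilizer times X_J, where J is the set of
simple roots not vanishing at x (`orbitSum_of_dominant`), so these orbit sums span the descent
space. If u standardizes x and t standardizes y, then ut standardizes the lexicographic pair (y·u⁻¹,
x) (`Standardizes.mul`); hence a product of orbit sums is a sum of orbit sums. All this is done for
a `ReflectionFrame`, which types B and D both instantiate.

For `χ`: χ(uw) equals χ(u)χ(w) or χ(u)·s₀χ(w)s₀, according to the parity of the signs of u. The
twist is invisible on the image of Σ(B_n): by exchange and parity, left multiplication by s₀ either
preserves the B-descent set of w or agrees with right multiplication (`desSet_signFlip_mul`), so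
each χ(Y_J) is fixed under conjugation by s₀.

The formulas are coefficient comparisons: the fibre of `χ` over v is {v, v s₀}, and the B-descents
of both words are read off from the D-descents of v and the sign of its first entry
(`desSet_relations`). -/

section DescentAlgebras

open Finset

/-! ### Signed permutations acting on tuples -/

/-- The integral linear form with coefficients `a`, evaluated on a tuple in an abelian group. -/
def linForm {n : ℕ} {G : Type*} [AddCommGroup G] (a : Fin n → ℤ) (x : Fin n → G) : G :=
  ∑ j, a j • x j

/-- The right action of signed permutations on tuples: the tuple `(1, …, n)` is sent to the
word of `w`. -/
def rightAct {n : ℕ} {G : Type*} [AddCommGroup G] (x : Fin n → G) (w : SignedPerm n) :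
    Fin n → G :=
  fun i => ((w.left (w.right i) : ℤˣ) : ℤ) • x (w.right i)

theorem rightAct_one {n : ℕ} {G : Type*} [AddCommGroup G] (x : Fin n → G) :
    rightAct x 1 = x := by
  funext i
  simp [rightAct]

theorem rightAct_mul {n : ℕ} {G : Type*} [AddCommGroup G] (x : Fin n → G) (u w : SignedPerm n) :
    rightAct x (u * w) = rightAct (rightAct x u) w := by
  funext i
  have h : (u * w).left ((u * w).right i) =
      u.left (u.right (w.right i)) * w.left (u.right⁻¹ (u.right (w.right i))) := rfl
  have h2 : (u * w).right i = u.right (w.right i) := rfl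
  unfold rightAct
  rw [h, h2, Equiv.Perm.inv_def, Equiv.symm_apply_apply, Units.val_mul, mul_comm, mul_smul]

/-- Two tuples combined into a tuple of lexicographically ordered pairs. -/
def lexPair {n : ℕ} {G H : Type*} (x : Fin n → G) (y : Fin n → H) : Fin n → G ×ₗ H :=
  fun i => toLex (x i, y i)

theorem rightAct_lexPair {n : ℕ} {G H : Type*} [AddCommGroup G] [AddCommGroup H]
    (x : Fin n → G) (y : Fin n → H) (w : SignedPerm n) :
    rightAct (lexPair x y) w = lexPair (rightAct x w) (rightAct y w) := rfl

theorem linForm_lexPair {n : ℕ} {G H : Type*} [AddCommGroup G] [AddCommGroup H]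
    (a : Fin n → ℤ) (x : Fin n → G) (y : Fin n → H) :
    linForm a (lexPair x y) = toLex (linForm a x, linForm a y) := by
  apply ofLex.injective
  have h : ofLex (linForm a (lexPair x y)) = ∑ j, (a j • x j, a j • y j) := by
    unfold linForm lexPair
    exact map_sum (⟨⟨ofLex, rfl⟩, fun _ _ => rfl⟩ : (G ×ₗ H) →+ G × H) _ _
  rw [h]
  refine Prod.ext ?_ ?_
  · rw [Prod.fst_sum]; rfl
  · rw [Prod.snd_sum]; rfl

theorem linForm_sub {n : ℕ} {G : Type*} [AddCommGroup G] (a : Fin n → ℤ) (x y : Fin n → G) :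
    linForm a (x - y) = linForm a x - linForm a y := by
  simp [linForm, smul_sub]

theorem linForm_smul {n : ℕ} {G : Type*} [AddCommGroup G] (a c : Fin n → ℤ) (g : G) :
    linForm a (fun k => c k • g) = linForm a c • g := by
  simp [linForm, sum_smul, mul_smul]

/-! ### Reflection groups realised by signed permutations -/

/-- A group `W` with generators `s i` which acts, through signed permutations, as a reflection
group with simple roots `root i`; the vector `rho` is regular and dominant. -/
structure ReflectionFrame {W ι : Type*} [Group W] (s : ι → W) (n : ℕ) where
  toSigned : W →* SignedPerm n
  root : ι → Fin n → ℤ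
  coroot : ι → Fin n → ℤ
  rho : Fin n → ℤ
  act_gen : ∀ (i : ι) {G : Type} [AddCommGroup G] (x : Fin n → G),
    rightAct x (toSigned (s i)) = x - fun k => coroot i k • linForm (root i) x
  root_coroot : ∀ i, linForm (root i) (coroot i) = 2
  rho_coroot : ∀ i, 0 < linForm rho (coroot i)
  root_rho : ∀ i, 0 < linForm (root i) rho
  root_rho_act_ne : ∀ w i, linForm (root i) (rightAct rho (toSigned w)) ≠ 0
  -- A root negative at `rho` is nonpositive on the whole closed chamber. The group `G` varies so
  -- that this applies to lexicographic pairs.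
  coherent : ∀ (w : W) (i : ι) {G : Type} [AddCommGroup G] [LinearOrder G] [IsOrderedAddMonoid G]
    (x : Fin n → G), (∀ j, 0 ≤ linForm (root j) x) →
      linForm (root i) (rightAct rho (toSigned w)) < 0 →
        linForm (root i) (rightAct x (toSigned w)) ≤ 0
  eq_one : ∀ w, (∀ i, 0 ≤ linForm (root i) (rightAct rho (toSigned w))) → w = 1
  -- The only positive root made negative by the reflection `s j` is the simple root `j`, so `w`
  -- must carry root `i` to root `j`.
  exchange : ∀ w i j, 0 < linForm (root i) (rightAct rho (toSigned w)) →
    linForm (root i) (rightAct rho (toSigned (s j * w))) < 0 → s j * w = w * s i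
  -- Every face of the dominant chamber contains an integral point in its relative interior.
  exists_dominant : ∀ J : Finset ι, ∃ x : Fin n → ℤ,
    ∀ i, 0 ≤ linForm (root i) x ∧ (linForm (root i) x = 0 ↔ i ∈ J)

namespace ReflectionFrame

variable {W ι : Type*} [Group W] {s : ι → W} {n : ℕ} (F : ReflectionFrame s n)

/-- The action of `W` on tuples. -/
def act {G : Type} [AddCommGroup G] (x : Fin n → G) (w : W) : Fin n → G :=
  rightAct x (F.toSigned w)

/-- The value of the simple root `i` on a tuple. -/
def val {G : Type} [AddCommGroup G] (i : ι) (x : Fin n → G) : G := linForm (F.root i) x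

/-! ### The reflection action and dominant representatives -/

section
variable {G : Type} [AddCommGroup G]

theorem act_one (x : Fin n → G) : F.act x 1 = x := by
  rw [act, map_one, rightAct_one]

theorem act_mul (x : Fin n → G) (u w : W) : F.act x (u * w) = F.act (F.act x u) w := by
  rw [act, map_mul, rightAct_mul]; rfl

theorem act_inv_act (x : Fin n → G) (w : W) : F.act (F.act x w⁻¹) w = x := by
  rw [← act_mul, inv_mul_cancel, act_one]

theorem val_act_gen (i : ι) (x : Fin n → G) : F.val i (F.act x (s i)) = -F.val i x := by
  rw [act, F.act_gen, val, linForm_sub, linForm_smul, F.root_coroot, val, two_smul]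
  abel

theorem act_gen_eq_self {i : ι} {x : Fin n → G} (h : F.val i x = 0) : F.act x (s i) = x := by
  rw [act, F.act_gen]
  funext k
  change x k - F.coroot i k • F.val i x = x k
  simp [h]

theorem gen_mul_self (F : ReflectionFrame s n) (i : ι) : s i * s i = 1 := by
  apply F.eq_one
  intro j
  have h : F.act F.rho (s i * s i) = F.rho := by
    rw [act_mul]
    funext k
    have h1 : F.act F.rho (s i) k = F.rho k - F.coroot i k • F.val i F.rho := by
      rw [act, F.act_gen]; rfl
    have h2 : F.act (F.act F.rho (s i)) (s i) k =
        F.act F.rho (s i) k - F.coroot i k • F.val i (F.act F.rho (s i)) := by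
      conv_lhs => rw [act, F.act_gen]
      rfl
    rw [h2, h1, val_act_gen]
    simp
  exact (congrArg (fun y => 0 ≤ linForm (F.root j) y) h).mpr (F.root_rho j).le

variable [LinearOrder G] [IsOrderedAddMonoid G]

theorem linForm_rho_act_gen (i : ι) {x : Fin n → G} (h : F.val i x < 0) :
    linForm F.rho x < linForm F.rho (F.act x (s i)) := by
  rw [act, F.act_gen, linForm_sub, linForm_smul]
  have := zsmul_pos (neg_pos.mpr h) (F.rho_coroot i)
  rw [smul_neg] at this
  exact (lt_add_iff_pos_right _).mpr this |>.trans_eq (sub_eq_add_neg _ _).symm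

/-- Maximise the pairing of `rho` with x·w over w in `H`: reflecting in a wall where the value is
negative would increase it. Keeping `H` general lets the closure of the generators be used before it
is known to be everything. -/
theorem exists_dominant_act [Finite W] (H : Subgroup W) (hH : ∀ i, s i ∈ H) (x : Fin n → G) :
    ∃ w ∈ H, ∀ i, 0 ≤ F.val i (F.act x w) := by
  obtain ⟨w, hw⟩ := Finite.exists_max fun w : H => linForm F.rho (F.act x w)
  refine ⟨w, w.2, fun i => ?_⟩
  by_contra! h
  have h1 := F.linForm_rho_act_gen i h
  rw [← act_mul] at h1
  have h2 : linForm F.rho (F.act x (w * s i)) ≤ linForm F.rho (F.act x w) :=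
    hw ⟨w * s i, mul_mem w.2 (hH i)⟩
  exact absurd h2 (not_le.mpr h1)

end

/-! ### Generation, exchange and descents -/

theorem closure_gen (F : ReflectionFrame s n) [Finite W] : Subgroup.closure (Set.range s) = ⊤ := by
  refine eq_top_iff.mpr fun w _ => ?_
  obtain ⟨h, hh, hd⟩ := F.exists_dominant_act (Subgroup.closure (Set.range s))
    (fun i => Subgroup.subset_closure ⟨i, rfl⟩) (F.act F.rho w)
  have : w * h = 1 := F.eq_one _ fun i => by
    have := hd i
    rwa [← act_mul] at this
  rw [eq_inv_of_mul_eq_one_left this]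
  exact inv_mem hh

theorem exists_word (F : ReflectionFrame s n) [Finite W] (w : W) : ∃ l : List ι, (l.map s).prod = w := by
  have hw : w ∈ Subgroup.closure (Set.range s) := F.closure_gen ▸ Subgroup.mem_top w
  induction hw using Subgroup.closure_induction with
  | mem x hx => obtain ⟨i, rfl⟩ := hx; exact ⟨[i], by simp⟩
  | one => exact ⟨[], rfl⟩
  | mul x y _ _ hx hy =>
    obtain ⟨l, rfl⟩ := hx
    obtain ⟨m, rfl⟩ := hy
    exact ⟨l ++ m, by simp⟩
  | inv x _ hx =>
    obtain ⟨l, rfl⟩ := hx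
    refine ⟨l.reverse, ?_⟩
    rw [List.prod_inv_reverse, List.map_reverse, List.map_map]
    congr 2
    refine List.map_congr_left fun i _ => ?_
    exact (inv_eq_of_mul_eq_one_right (F.gen_mul_self i)).symm

/-- The index `i` is a descent of `w`. -/
def Desc (w : W) (i : ι) : Prop := F.val i (F.act F.rho w) < 0

theorem not_desc_iff {w : W} {i : ι} : ¬ F.Desc w i ↔ 0 < F.val i (F.act F.rho w) :=
  ⟨fun h => lt_of_le_of_ne (not_lt.mp h) (F.root_rho_act_ne w i).symm, fun h => not_lt.mpr h.le⟩

theorem desc_mul_gen {w : W} {i : ι} : F.Desc (w * s i) i ↔ ¬ F.Desc w i := by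
  rw [not_desc_iff, Desc, act_mul, val_act_gen, neg_lt_zero]

theorem mul_gen_mul_gen (F : ReflectionFrame s n) (w : W) (i : ι) : w * s i * s i = w := by
  rw [mul_assoc, F.gen_mul_self, mul_one]

/-- The deletion property. Take the longest suffix p without descent `i`; prepending the next letter
j creates the descent, so `exchange` gives s_j p = p s_i, and multiplying by s_i on the right
deletes j. -/
theorem exists_shorter_word (i : ι) (l : List ι) (h : F.Desc (l.map s).prod i) :
    ∃ m : List ι, m.length + 1 = l.length ∧ (m.map s).prod = (l.map s).prod * s i := by
  induction l with
  | nil =>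
    refine absurd h (F.not_desc_iff.mpr ?_)
    rw [List.map_nil, List.prod_nil, act_one]
    exact F.root_rho i
  | cons j l ih =>
    by_cases hl : F.Desc (l.map s).prod i
    · obtain ⟨m, hm, hp⟩ := ih hl
      exact ⟨j :: m, by simp [hm], by simp [hp, mul_assoc]⟩
    · refine ⟨l, rfl, ?_⟩
      rw [List.map_cons, List.prod_cons] at h ⊢
      rw [F.exchange _ i j (F.not_desc_iff.mp hl) h, F.mul_gen_mul_gen]

theorem wordLength_mul_gen_lt [Finite W] {w : W} {i : ι} (h : F.Desc w i) :
    wordLength s (w * s i) < wordLength s w := by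
  have hne : {k : ℕ | ∃ l : List ι, l.length = k ∧ (l.map s).prod = w}.Nonempty := by
    obtain ⟨l, hl⟩ := F.exists_word w
    exact ⟨_, l, rfl, hl⟩
  obtain ⟨l, hl, hw⟩ := Nat.sInf_mem hne
  obtain ⟨m, hm, hp⟩ := F.exists_shorter_word i l (hw.symm ▸ h)
  have h1 : wordLength s (w * s i) ≤ m.length := Nat.sInf_le ⟨m, rfl, by rw [hp, hw]⟩
  have h2 : l.length = wordLength s w := hl
  omega

/-- Links length to geometry. For the converse, a non-descent of `w` is a descent of `w * s i`,
which is then strictly longer than `w`. -/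
theorem mem_desSet [Finite W] [Fintype ι] {w : W} {i : ι} : i ∈ desSet s w ↔ F.Desc w i := by
  rw [desSet, mem_filter_univ]
  refine ⟨fun h => ?_, F.wordLength_mul_gen_lt⟩
  by_contra hd
  have := F.wordLength_mul_gen_lt (F.desc_mul_gen.mpr hd)
  rw [F.mul_gen_mul_gen] at this
  exact lt_asymm h this

/-! ### The dominant chamber as a fundamental domain -/

section
variable {G : Type} [AddCommGroup G] [LinearOrder G] [IsOrderedAddMonoid G]

theorem val_act_nonneg {w : W} {i : ι} {x : Fin n → G} (hx : ∀ j, 0 ≤ F.val j x)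
    (h : ¬ F.Desc w i) : 0 ≤ F.val i (F.act x w) := by
  have := F.coherent (w * s i) i x hx (F.desc_mul_gen.mpr h)
  change F.val i (F.act x (w * s i)) ≤ 0 at this
  rw [act_mul, val_act_gen] at this
  exact neg_nonpos.mp this

/-- Induction on length: at a descent `i` of `w`, coherence and dominance force x·w onto the wall
`i`, so the shorter `w * s i` moves `x` to the same place. -/
theorem act_eq_of_dominant [Finite W] {x : Fin n → G} (hx : ∀ j, 0 ≤ F.val j x) (w : W)
    (hw : ∀ j, 0 ≤ F.val j (F.act x w)) : F.act x w = x := by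
  induction hk : wordLength s w using Nat.strong_induction_on generalizing w with
  | _ k ih =>
    by_cases h : ∃ i, F.Desc w i
    · obtain ⟨i, hi⟩ := h
      have h0 : F.val i (F.act x w) = 0 := le_antisymm (F.coherent w i x hx hi) (hw i)
      have h1 : F.act x (w * s i) = F.act x w := by rw [act_mul, F.act_gen_eq_self h0]
      rw [← h1]
      exact ih _ (hk ▸ F.wordLength_mul_gen_lt hi) _ (by rwa [h1]) rfl
    · push Not at h
      rw [F.eq_one w fun i => (F.not_desc_iff.mp (h i)).le, act_one]

end

/-! ### Standardization of tuples -/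

section
variable {G : Type} [AddCommGroup G]

/-- `u` standardizes `x`: it makes `x` dominant and has no descent at the walls containing the
result. -/
def Standardizes [LinearOrder G] (x : Fin n → G) (u : W) : Prop :=
  ∀ i, 0 ≤ F.val i (F.act x u) ∧ (F.val i (F.act x u) = 0 → ¬ F.Desc u i)

/-- The descent condition on walls says exactly that `rho` breaks ties, so standardizing `x` means
bringing a regular lexicographic pair into the open chamber. -/
theorem standardizes_iff [LinearOrder G] {x : Fin n → G} {u : W} :
    F.Standardizes x u ↔ ∀ i, 0 < F.val i (F.act (lexPair x F.rho) u) := by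
  refine forall_congr' fun i => ?_
  have h : F.val i (F.act (lexPair x F.rho) u) =
      toLex (F.val i (F.act x u), F.val i (F.act F.rho u)) := linForm_lexPair _ _ _
  have h0 : (0 : G ×ₗ ℤ) = toLex (0, 0) := rfl
  rw [h, h0, Prod.Lex.toLex_lt_toLex', not_desc_iff, eq_comm (a := (0 : G))]

theorem val_lexPair_rho_ne (x : Fin n → G) (u : W) (i : ι) :
    F.val i (F.act (lexPair x F.rho) u) ≠ 0 := by
  have h : F.val i (F.act (lexPair x F.rho) u) =
      toLex (F.val i (F.act x u), F.val i (F.act F.rho u)) := linForm_lexPair _ _ _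
  intro h0
  rw [h] at h0
  exact F.root_rho_act_ne u i (congrArg (fun p => (ofLex p).2) h0)

variable [LinearOrder G] [IsOrderedAddMonoid G]

theorem exists_standardizes [Finite W] (x : Fin n → G) : ∃ u : W, F.Standardizes x u := by
  obtain ⟨u, -, hu⟩ := F.exists_dominant_act ⊤ (fun _ => Subgroup.mem_top _) (lexPair x F.rho)
  exact ⟨u, F.standardizes_iff.mpr fun i =>
    lt_of_le_of_ne (hu i) (F.val_lexPair_rho_ne x u i).symm⟩

theorem Standardizes.val_act_pos {x : Fin n → G} {u t : W} (hu : F.Standardizes x u) {i : ι}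
    (h : ¬ F.Desc t i) : 0 < F.val i (F.act (lexPair x F.rho) (u * t)) := by
  rw [standardizes_iff] at hu
  refine lt_of_le_of_ne ?_ (F.val_lexPair_rho_ne x _ i).symm
  rw [act_mul]
  exact F.val_act_nonneg (fun j => (hu j).le) h

theorem Standardizes.unique {x : Fin n → G} {u v : W} (hu : F.Standardizes x u)
    (hv : F.Standardizes x v) : u = v := by
  rw [standardizes_iff] at hu hv
  have h : u⁻¹ * v = 1 := by
    refine F.eq_one _ fun i => ?_
    by_contra! hd
    have h1 := F.coherent (u⁻¹ * v) i _ (fun j => (hu j).le) hd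
    change F.val i (F.act _ _) ≤ 0 at h1
    rw [← act_mul, mul_inv_cancel_left] at h1
    exact absurd (hv i) (not_lt.mpr h1)
  rw [← inv_mul_eq_one]; exact h

/-- Applying ut to y·u⁻¹ gives y·t, which is dominant. On a wall containing y·t, `t` has no descent,
so it keeps the value of the strictly dominant pair (x, ρ)·u positive there; this settles the second
component and the remaining ties. -/
theorem Standardizes.mul {H : Type} [AddCommGroup H] [LinearOrder H] [IsOrderedAddMonoid H]
    {x : Fin n → G} {y : Fin n → H} {u t : W} (hu : F.Standardizes x u)
    (ht : F.Standardizes y t) : F.Standardizes (lexPair (F.act y u⁻¹) x) (u * t) := by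
  intro i
  have h : F.val i (F.act (lexPair (F.act y u⁻¹) x) (u * t)) =
      toLex (F.val i (F.act y t), F.val i (F.act x (u * t))) := by
    refine (linForm_lexPair _ _ _).trans ?_
    change toLex (F.val i (F.act (F.act y u⁻¹) (u * t)), _) = _
    rw [act_mul _ _ u t, act_inv_act]
    rfl
  have h0 : (0 : H ×ₗ G) = toLex (0, 0) := rfl
  have key : F.val i (F.act y t) = 0 → 0 ≤ F.val i (F.act x (u * t)) ∧
      (F.val i (F.act x (u * t)) = 0 → ¬ F.Desc (u * t) i) := by
    intro hz
    have h1 := Standardizes.val_act_pos F hu ((ht i).2 hz)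
    have h2 : F.val i (F.act (lexPair x F.rho) (u * t)) =
      toLex (F.val i (F.act x (u * t)), F.val i (F.act F.rho (u * t))) := linForm_lexPair _ _ _
    have h3 : (0 : G ×ₗ ℤ) = toLex (0, 0) := rfl
    rw [h2, h3, Prod.Lex.toLex_lt_toLex'] at h1
    rw [not_desc_iff]
    exact ⟨h1.1, fun e => h1.2 e.symm⟩
  rw [h, h0, Prod.Lex.toLex_le_toLex']
  refine ⟨⟨(ht i).1, fun e => (key e.symm).1⟩, fun e => ?_⟩
  have e1 := congrArg (fun p => (ofLex p).1) e
  have e2 := congrArg (fun p => (ofLex p).2) e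
  exact (key e1).2 e2

end

section
variable [Finite W] {G : Type} [AddCommGroup G] [LinearOrder G] [IsOrderedAddMonoid G]

/-- The standardization of a tuple. -/
noncomputable def std (x : Fin n → G) : W := (F.exists_standardizes x).choose

theorem std_spec (x : Fin n → G) : F.Standardizes x (F.std x) :=
  (F.exists_standardizes x).choose_spec

theorem std_eq_iff {x : Fin n → G} {u : W} : F.std x = u ↔ F.Standardizes x u :=
  ⟨fun h => h ▸ F.std_spec x, fun h => Standardizes.unique F (F.std_spec x) h⟩

end

end ReflectionFrame

/-! ### The X family spans the same space as the Y family -/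

theorem basisX_eq_sum {W ι : Type*} [Group W] [Fintype W] [Fintype ι] (s : ι → W) (J : Finset ι)
    [DecidablePred fun w : W => desSet s w ⊆ J] :
    basisX s J = ∑ w : W, if desSet s w ⊆ J then MonoidAlgebra.of ℚ W w else 0 := by
  classical
  unfold basisX basisY
  simp_rw [sum_filter]
  rw [sum_comm]
  refine sum_congr rfl fun w _ => ?_
  rw [sum_ite_eq]
  simp only [mem_powerset]

theorem basisX_mem_descentSpan {W ι : Type*} [Group W] [Fintype W] [Fintype ι] (s : ι → W)
    (J : Finset ι) : basisX s J ∈ descentSpan s :=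
  Submodule.sum_mem _ fun I _ => Submodule.subset_span ⟨I, rfl⟩

theorem basisY_mem_span_basisX {W ι : Type*} [Group W] [Fintype W] [Fintype ι] (s : ι → W)
    (J : Finset ι) : basisY s J ∈ Submodule.span ℚ (Set.range (basisX s)) := by
  classical
  induction J using Finset.strongInduction with
  | H J ih =>
    have h : basisX s J = basisY s J + ∑ I ∈ J.ssubsets, basisY s I := by
      unfold basisX
      rw [ssubsets, add_sum_erase _ _ (mem_powerset_self J)]
    rw [← sub_eq_iff_eq_add] at h
    rw [← h]
    exact Submodule.sub_mem _ (Submodule.subset_span ⟨J, rfl⟩)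
      (Submodule.sum_mem _ fun I hI => ih I (mem_ssubsets.mp hI))

namespace ReflectionFrame

variable {W ι : Type*} [Group W] {s : ι → W} {n : ℕ} (F : ReflectionFrame s n)
variable [Fintype W]

/-! ### Orbit sums and Solomon's theorem -/

section
variable {G : Type} [AddCommGroup G] [LinearOrder G] [IsOrderedAddMonoid G]

/-- The sum of the standardizations of all translates of a tuple. -/
noncomputable def orbitSum (x : Fin n → G) : MonoidAlgebra ℚ W :=
  ∑ w : W, MonoidAlgebra.of ℚ W (F.std (F.act x w))

theorem orbitSum_act (x : Fin n → G) (v : W) : F.orbitSum (F.act x v) = F.orbitSum x := by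
  unfold orbitSum
  simp_rw [← act_mul]
  exact Equiv.sum_comp (Equiv.mulLeft v) fun w => MonoidAlgebra.of ℚ W (F.std (F.act x w))

open Classical in
theorem standardizes_act_mul_inv_iff [Fintype ι] {x : Fin n → G} (hx : ∀ i, 0 ≤ F.val i x)
    (w u : W) : F.Standardizes (F.act x (w * u⁻¹)) u ↔
      F.act x w = x ∧ desSet s u ⊆ ({i | F.val i x ≠ 0} : Finset ι) := by
  unfold Standardizes
  rw [← act_mul, inv_mul_cancel_right]
  constructor
  · intro h
    have h1 := F.act_eq_of_dominant hx w fun i => (h i).1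
    refine ⟨h1, fun i hi => ?_⟩
    rw [mem_filter_univ]
    intro h0
    exact (h i).2 (by rw [h1, h0]) (F.mem_desSet.mp hi)
  · rintro ⟨h1, h2⟩ i
    rw [h1]
    exact ⟨hx i, fun h0 hd => (mem_filter_univ i).mp (h2 (F.mem_desSet.mpr hd)) h0⟩

open Classical in
-- Count pairs (w, u) with u standardizing x·w. After replacing w by wu⁻¹ the condition splits into
-- "w fixes x" and "the descents of u avoid the walls containing x", whence a product.
theorem orbitSum_of_dominant [Fintype ι] {x : Fin n → G} (hx : ∀ i, 0 ≤ F.val i x) :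
    F.orbitSum x = #{w : W | F.act x w = x} • basisX s ({i | F.val i x ≠ 0} : Finset ι) := by
  have h1 : F.orbitSum x = ∑ w : W, ∑ u : W,
      if F.Standardizes (F.act x w) u then MonoidAlgebra.of ℚ W u else 0 := by
    refine sum_congr rfl fun w _ => ?_
    simp_rw [← std_eq_iff]
    rw [sum_ite_eq, if_pos (mem_univ _)]
  have h2 : ∀ u : W, (∑ w : W,
      if F.Standardizes (F.act x w) u then MonoidAlgebra.of ℚ W u else 0) =
      ∑ w : W, if F.act x w = x ∧ desSet s u ⊆ ({i | F.val i x ≠ 0} : Finset ι)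
        then MonoidAlgebra.of ℚ W u else 0 := by
    intro u
    rw [← Equiv.sum_comp (Equiv.mulRight u⁻¹)]
    simp only [Equiv.coe_mulRight, F.standardizes_act_mul_inv_iff hx]
  rw [h1, sum_comm, sum_congr rfl fun u _ => h2 u, sum_comm]
  simp_rw [ite_and]
  rw [← sum_const, sum_filter]
  refine sum_congr rfl fun w _ => ?_
  split_ifs
  · rw [basisX_eq_sum]
  · simp

theorem orbitSum_mem_descentSpan [Fintype ι] (x : Fin n → G) :
    F.orbitSum x ∈ descentSpan s := by
  obtain ⟨w, -, hw⟩ := F.exists_dominant_act ⊤ (fun _ => Subgroup.mem_top _) x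
  rw [← F.orbitSum_act x w, F.orbitSum_of_dominant hw]
  exact Submodule.smul_of_tower_mem _ _ (basisX_mem_descentSpan _ _)

theorem orbitSum_mul_orbitSum {H : Type} [AddCommGroup H] [LinearOrder H] [IsOrderedAddMonoid H]
    (x : Fin n → G) (y : Fin n → H) :
    F.orbitSum x * F.orbitSum y = ∑ v : W, F.orbitSum (lexPair (F.act y v) x) := by
  have h : ∀ w v : W, MonoidAlgebra.of ℚ W (F.std (F.act x w)) *
      MonoidAlgebra.of ℚ W (F.std (F.act y v)) = MonoidAlgebra.of ℚ W
        -- For fixed `w`, the correction of `v` is a right translation of the group, so it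
        -- disappears after summing over `v`. The trailing `w⁻¹` lets `w` act on the whole pair.
        (F.std (F.act (lexPair (F.act y (v * (F.std (F.act x w))⁻¹ * w⁻¹)) x) w)) := by
    intro w v
    rw [← map_mul]
    congr 1
    symm
    rw [std_eq_iff]
    have h1 := Standardizes.mul F (F.std_spec (F.act x w)) (F.std_spec (F.act y v))
    convert h1 using 1
    refine (rightAct_lexPair _ _ _).trans ?_
    change lexPair (F.act (F.act y _) w) (F.act x w) = _
    rw [← act_mul, ← act_mul, inv_mul_cancel_right]
  unfold orbitSum
  rw [sum_mul_sum, sum_comm (s := univ (α := W)) (f := fun v w => MonoidAlgebra.of ℚ W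
    (F.std (F.act (lexPair (F.act y v) x) w)))]
  refine sum_congr rfl fun w _ => ?_
  rw [sum_congr rfl fun v _ => h w v]
  simp_rw [mul_assoc]
  exact Equiv.sum_comp (Equiv.mulRight ((F.std (F.act x w))⁻¹ * w⁻¹)) fun v =>
    MonoidAlgebra.of ℚ W (F.std (F.act (lexPair (F.act y v) x) w))

end

variable [Fintype ι]

theorem basisX_mem_span_orbitSum (J : Finset ι) :
    basisX s J ∈ Submodule.span ℚ (Set.range fun x : Fin n → ℤ => F.orbitSum x) := by
  classical
  -- The complement appears because the orbit sum produces X indexed by the roots that do not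
  -- vanish.
  obtain ⟨x, hx⟩ := F.exists_dominant Jᶜ
  have h := F.orbitSum_of_dominant fun i => (hx i).1
  have hJ : ({i | F.val i x ≠ 0} : Finset ι) = J := by
    ext i
    rw [mem_filter_univ, ne_eq, ← notMem_compl (s := J)]
    exact not_congr (hx i).2
  rw [hJ] at h
  have hc : (#{w : W | F.act x w = x} : ℚ) ≠ 0 := by
    rw [Nat.cast_ne_zero, ← Nat.pos_iff_ne_zero, card_pos]
    exact ⟨1, (mem_filter_univ _).mpr (F.act_one x)⟩
  have h2 : basisX s J = (#{w : W | F.act x w = x} : ℚ)⁻¹ • F.orbitSum x := by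
    rw [h, ← Nat.cast_smul_eq_nsmul ℚ, inv_smul_smul₀ hc]
  rw [h2]
  exact Submodule.smul_mem _ _ (Submodule.subset_span ⟨x, rfl⟩)

theorem descentSpan_eq_span_orbitSum :
    descentSpan s = Submodule.span ℚ (Set.range fun x : Fin n → ℤ => F.orbitSum x) := by
  apply le_antisymm
  · refine Submodule.span_le.mpr ?_
    rintro _ ⟨J, rfl⟩
    refine Submodule.span_le.mpr ?_ (basisY_mem_span_basisX s J)
    rintro _ ⟨K, rfl⟩
    exact F.basisX_mem_span_orbitSum K
  · refine Submodule.span_le.mpr ?_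
    rintro _ ⟨x, rfl⟩
    exact F.orbitSum_mem_descentSpan x

/-- Solomon's theorem: the descent span is closed under multiplication. -/
theorem mul_mem_descentSpan (F : ReflectionFrame s n) {a b : MonoidAlgebra ℚ W} (ha : a ∈ descentSpan s)
    (hb : b ∈ descentSpan s) : a * b ∈ descentSpan s := by
  have h : descentSpan s * descentSpan s ≤ descentSpan s := by
    conv_lhs => rw [F.descentSpan_eq_span_orbitSum, Submodule.span_mul_span]
    refine Submodule.span_le.mpr ?_
    rintro _ ⟨_, ⟨x, rfl⟩, _, ⟨y, rfl⟩, rfl⟩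
    change F.orbitSum x * F.orbitSum y ∈ _
    -- The product involves tuples over the lexicographic square of ℤ; their orbit sums still lie in
    -- the span, since that holds over any ordered group.
    rw [orbitSum_mul_orbitSum]
    exact Submodule.sum_mem _ fun v _ => F.orbitSum_mem_descentSpan _
  exact h (Submodule.mul_mem_mul ha hb)

theorem desSet_eq_empty_iff (F : ReflectionFrame s n) (w : W) : desSet s w = ∅ ↔ w = 1 := by
  rw [eq_empty_iff_forall_notMem]
  simp_rw [F.mem_desSet, not_desc_iff]
  refine ⟨fun h => F.eq_one w fun i => (h i).le, ?_⟩
  rintro rfl i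
  rw [act_one]
  exact F.root_rho i

theorem basisY_empty (F : ReflectionFrame s n) : basisY s ∅ = 1 := by
  refine (sum_congr (s₂ := {1}) ?_ fun _ _ => rfl).trans (by rw [sum_singleton, map_one])
  ext w
  simp [F.desSet_eq_empty_iff]

/-- Solomon's descent algebra. -/
noncomputable def descentAlgebra (F : ReflectionFrame s n) :
    Subalgebra ℚ (MonoidAlgebra ℚ W) :=
  (descentSpan s).toSubalgebra (Submodule.subset_span ⟨∅, F.basisY_empty⟩)
    fun _ _ => F.mul_mem_descentSpan

end ReflectionFrame

/-! ### Words of signed permutations -/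

section Words

variable {n : ℕ}

/-- The position to the left of `i`. -/
def predPos (i : Fin n) : Fin n := ⟨i.val - 1, by omega⟩

/-- The first position. -/
def firstPos (hn : 2 ≤ n) : Fin n := ⟨0, by omega⟩

/-- The second position. -/
def secondPos (hn : 2 ≤ n) : Fin n := ⟨1, by omega⟩

theorem predPos_ne {i : Fin n} (hi : i.val ≠ 0) : predPos i ≠ i := by
  intro h
  have : i.val - 1 = i.val := congrArg Fin.val h
  omega

theorem firstPos_ne_secondPos (hn : 2 ≤ n) : firstPos hn ≠ secondPos hn := by
  intro h
  have : 0 = 1 := congrArg Fin.val h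
  omega

/-- The tuple `(1, …, n)`. -/
def rhoVec (n : ℕ) : Fin n → ℤ := fun k => (k.val : ℤ) + 1

theorem rightAct_elemTransp {G : Type*} [AddCommGroup G] (x : Fin n → G) (i k : Fin n) :
    rightAct x (elemTransp i) k = x (Equiv.swap (predPos i) i k) := by
  simp [rightAct, elemTransp, predPos]

theorem rightAct_signFlip {G : Type*} [AddCommGroup G] (hn : 2 ≤ n) (x : Fin n → G) (k : Fin n) :
    rightAct x (signFlip hn) k = if k = firstPos hn then -x k else x k := by
  by_cases h : k = firstPos hn
  · rw [if_pos h, h]; simp [rightAct, signFlip, firstPos]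
  · rw [if_neg h]
    have : (Pi.mulSingle (firstPos hn) (-1) : Fin n → ℤˣ) k = 1 := Pi.mulSingle_eq_of_ne h _
    simp only [firstPos] at this
    simp [rightAct, signFlip, this]

theorem rightAct_signSwap {G : Type*} [AddCommGroup G] (hn : 2 ≤ n) (x : Fin n → G) (k : Fin n) :
    rightAct x (signSwap hn) k = if k = firstPos hn then -x (secondPos hn)
      else if k = secondPos hn then -x (firstPos hn) else x k := by
  have hne := firstPos_ne_secondPos hn
  have h : rightAct x (signSwap hn) k =
      (((Pi.mulSingle (firstPos hn) (-1) * Pi.mulSingle (secondPos hn) (-1) : Fin n → ℤˣ)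
        (Equiv.swap (firstPos hn) (secondPos hn) k) : ℤˣ) : ℤ) •
        x (Equiv.swap (firstPos hn) (secondPos hn) k) := rfl
  rw [h]
  split_ifs with h0 h1
  · rw [h0, Equiv.swap_apply_left]
    simp [Pi.mulSingle_eq_of_ne hne.symm]
  · rw [h1, Equiv.swap_apply_right]
    simp [Pi.mulSingle_eq_of_ne hne]
  · rw [Equiv.swap_apply_of_ne_of_ne h0 h1]
    simp [Pi.mulSingle_eq_of_ne h0, Pi.mulSingle_eq_of_ne h1]

theorem rightAct_eq {G : Type*} [AddCommGroup G] (x : Fin n → G) (w : SignedPerm n) (k : Fin n) :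
    rightAct x w k = ((w.left (w.right k) : ℤˣ) : ℤ) • x (w.right k) := rfl

theorem coe_unit_eq (e : ℤˣ) : (e : ℤ) = 1 ∨ (e : ℤ) = -1 := by
  rcases Int.units_eq_one_or e with h | h <;> simp [h]

theorem monotone_of_predPos_le {G : Type*} [Preorder G] {x : Fin n → G}
    (h : ∀ k : Fin n, k.val ≠ 0 → x (predPos k) ≤ x k) : Monotone x := by
  intro a b hab
  obtain ⟨b, hb⟩ := b
  replace hab : a.val ≤ b := hab
  induction b with
  | zero =>
    exact (congrArg x (Fin.ext (Nat.le_zero.mp hab))).le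
  | succ b ih =>
    rcases hab.lt_or_eq with h1 | h1
    · have h2 := ih (Nat.lt_of_succ_lt hb) (Nat.lt_succ_iff.mp h1)
      exact h2.trans (h ⟨b + 1, hb⟩ (Nat.succ_ne_zero b))
    · exact (congrArg x (Fin.ext h1)).le

/-- The core of coherence in both types: `hx` and `hx'` describe the closed D-chamber, which
contains the B-chamber, and the forms are the roots ±e_a ± e_b. -/
theorem smul_add_smul_nonpos {G : Type*} [AddCommGroup G] [PartialOrder G] [IsOrderedAddMonoid G]
    {x : Fin n → G} (hx : Monotone x) (hx' : ∀ a b, a ≠ b → 0 ≤ x a + x b) {a b : Fin n}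
    (hab : a ≠ b) {e f : ℤ} (he : e = 1 ∨ e = -1) (hf : f = 1 ∨ f = -1)
    (h : e * rhoVec n a + f * rhoVec n b < 0) : e • x a + f • x b ≤ 0 := by
  unfold rhoVec at h
  rcases he with rfl | rfl <;> rcases hf with rfl | rfl
  · omega
  · simp only [one_smul, neg_smul, ← sub_eq_add_neg, sub_nonpos]
    exact hx (Fin.le_def.mpr (by omega))
  · simp only [one_smul, neg_smul, neg_add_eq_sub, sub_nonpos]
    exact hx (Fin.le_def.mpr (by omega))
  · simp only [one_smul, neg_smul, ← neg_add, neg_nonpos]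
    exact hx' a b hab

theorem rightAct_rhoVec_injective :
    Function.Injective (rightAct (rhoVec n) : SignedPerm n → Fin n → ℤ) := by
  intro u v h
  have h1 : ∀ k, u.right k = v.right k ∧ u.left (u.right k) = v.left (v.right k) := by
    intro k
    have hk := congrFun h k
    rw [rightAct_eq, rightAct_eq] at hk
    simp only [rhoVec, smul_eq_mul] at hk
    rcases Int.units_eq_one_or (u.left (u.right k)) with h1 | h1 <;>
      rcases Int.units_eq_one_or (v.left (v.right k)) with h2 | h2 <;>
      rw [h1, h2] at hk ⊢ <;>
      simp only [Units.val_one, Units.val_neg] at hk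
    · exact ⟨Fin.ext (by omega), rfl⟩
    · omega
    · omega
    · exact ⟨Fin.ext (by omega), rfl⟩
  have hr : u.right = v.right := Equiv.ext fun k => (h1 k).1
  refine SemidirectProduct.ext (funext fun a => ?_) hr
  have := (h1 (u.right⁻¹ a)).2
  rw [← hr] at this
  simpa using this

/-- An increasing word with w₁ + w₂ ≥ 0 has positive entries from the second on, and |w₁| ≤ w₂, so
its absolute values increase. Only the sign of the letter 1 stays free: type B fixes it by w₁ ≥ 0,
type D by parity. -/
theorem right_eq_one_of_word (hn : 2 ≤ n) {w : SignedPerm n}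
    (h : ∀ k : Fin n, k.val ≠ 0 →
      rightAct (rhoVec n) w (predPos k) ≤ rightAct (rhoVec n) w k)
    (h0 : 0 ≤ rightAct (rhoVec n) w (firstPos hn) + rightAct (rhoVec n) w (secondPos hn)) :
    w.right = 1 ∧ ∀ k : Fin n, k.val ≠ 0 → w.left k = 1 := by
  have hm := monotone_of_predPos_le h
  have hpos : ∀ k : Fin n, k.val ≠ 0 → w.left (w.right k) = 1 := by
    intro k hk
    have h1 : rightAct (rhoVec n) w (firstPos hn) ≤ rightAct (rhoVec n) w (secondPos hn) :=
      hm (Fin.le_def.mpr (by simp [firstPos]))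
    have h2 : rightAct (rhoVec n) w (secondPos hn) ≤ rightAct (rhoVec n) w k :=
      hm (Fin.le_def.mpr (by simp only [secondPos]; omega))
    have h3 : 0 ≤ rightAct (rhoVec n) w k := by omega
    refine (Int.units_eq_one_or _).resolve_right fun h4 => ?_
    rw [rightAct_eq, h4] at h3
    simp only [rhoVec, Units.val_neg, Units.val_one, smul_eq_mul] at h3
    omega
  have hmono : Monotone w.right := by
    refine monotone_of_predPos_le fun k hk => ?_
    have hk1 := h k hk
    rw [rightAct_eq _ _ k, hpos k hk] at hk1
    rw [Fin.le_def]
    by_cases hk0 : (predPos k).val = 0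
    · have e1 : predPos k = firstPos hn := Fin.ext hk0
      have e2 : k = secondPos hn := Fin.ext (by simp only [predPos, secondPos] at hk0 ⊢; omega)
      rw [← e1, ← e2, rightAct_eq _ _ k, hpos k hk] at h0
      rw [rightAct_eq] at h0 hk1
      rcases coe_unit_eq (w.left (w.right (predPos k))) with h5 | h5 <;> rw [h5] at h0 hk1 <;>
        simp only [rhoVec, Units.val_one, smul_eq_mul] at h0 hk1 <;> omega
    · rw [rightAct_eq, hpos _ hk0] at hk1
      simp only [rhoVec, Units.val_one, smul_eq_mul] at hk1
      omega
  have hr : w.right = 1 := by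
    have h6 : (w.right : Fin n → Fin n) = id :=
      ((hmono.strictMono_of_injective w.right.injective).range_inj strictMono_id).mp
        (by rw [w.right.surjective.range_eq, Set.range_id])
    exact Equiv.ext fun k => congrFun h6 k
  refine ⟨hr, fun k hk => ?_⟩
  have := hpos k hk
  rwa [hr] at this

theorem linForm_single_sub_single {G : Type*} [AddCommGroup G] (i : Fin n) (x : Fin n → G) :
    linForm (Pi.single i 1 - Pi.single (predPos i) 1) x = x i - x (predPos i) := by
  simp [linForm, sub_smul, Pi.single_apply, ite_smul]

end Words

/-! ### The reflection frames of types B and D -/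

section Frames

variable {n : ℕ}

/-- The root `e_i - e_{i-1}`. -/
def diffRoot (i : Fin n) : Fin n → ℤ := Pi.single i 1 - Pi.single (predPos i) 1

/-- The simple roots of type B. -/
def rootB (i : Fin n) : Fin n → ℤ := if i.val = 0 then Pi.single i 1 else diffRoot i

/-- The simple coroots of type B. -/
def corootB (i : Fin n) : Fin n → ℤ := if i.val = 0 then Pi.single i 2 else diffRoot i

/-- The simple roots of type D. -/
def rootD (hn : 2 ≤ n) (i : Fin n) : Fin n → ℤ :=
  if i.val = 0 then Pi.single (firstPos hn) 1 + Pi.single (secondPos hn) 1 else diffRoot i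

theorem linForm_rootB {G : Type*} [AddCommGroup G] (i : Fin n) (x : Fin n → G) :
    linForm (rootB i) x = if i.val = 0 then x i else x i - x (predPos i) := by
  unfold rootB
  split_ifs
  · simp [linForm, Pi.single_apply, ite_smul]
  · exact linForm_single_sub_single i x

theorem linForm_rootD {G : Type*} [AddCommGroup G] (hn : 2 ≤ n) (i : Fin n) (x : Fin n → G) :
    linForm (rootD hn i) x =
      if i.val = 0 then x (firstPos hn) + x (secondPos hn) else x i - x (predPos i) := by
  unfold rootD
  split_ifs
  · simp [linForm, add_smul, Pi.single_apply, ite_smul, sum_add_distrib]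
  · exact linForm_single_sub_single i x

theorem linForm_comm (a b : Fin n → ℤ) : linForm a b = linForm b a := by
  simp [linForm, mul_comm]

theorem firstPos_val (hn : 2 ≤ n) : (firstPos hn).val = 0 := rfl

theorem eq_firstPos (hn : 2 ≤ n) {i : Fin n} (hi : i.val = 0) : i = firstPos hn := Fin.ext hi

theorem rightAct_elemTransp_eq_sub {G : Type*} [AddCommGroup G] {i : Fin n} (hi : i.val ≠ 0)
    (x : Fin n → G) :
    rightAct x (elemTransp i) = x - fun k => diffRoot i k • (x i - x (predPos i)) := by
  have hne := predPos_ne hi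
  funext k
  rw [rightAct_elemTransp]
  simp only [Pi.sub_apply, diffRoot]
  by_cases h1 : k = i
  · subst h1
    rw [Equiv.swap_apply_right, Pi.single_eq_same, Pi.single_eq_of_ne hne.symm]
    simp
  · by_cases h2 : k = predPos i
    · rw [h2, Equiv.swap_apply_left, Pi.single_eq_same, Pi.single_eq_of_ne hne]
      simp
    · rw [Equiv.swap_apply_of_ne_of_ne h2 h1, Pi.single_eq_of_ne h1, Pi.single_eq_of_ne h2]
      simp

theorem sign_combination_ne {a b : Fin n} (hab : a ≠ b) {e f : ℤ} (he : e = 1 ∨ e = -1)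
    (hf : f = 1 ∨ f = -1) : e * rhoVec n a + f * rhoVec n b ≠ 0 := by
  have : a.val ≠ b.val := fun h => hab (Fin.ext h)
  unfold rhoVec
  rcases he with rfl | rfl <;> rcases hf with rfl | rfl <;> omega

/-- The value at `v` of the tuple `(1, …, n)` acted on by the adjacent transposition `j`. -/
theorem rightAct_rhoVec_elemTransp {j : Fin n} (hj : j.val ≠ 0) (v : Fin n) :
    (v.val + 1 = j.val ∧ rightAct (rhoVec n) (elemTransp j) v = v.val + 2) ∨
    (v.val = j.val ∧ rightAct (rhoVec n) (elemTransp j) v = v.val) ∨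
    (v.val + 1 ≠ j.val ∧ v.val ≠ j.val ∧
      rightAct (rhoVec n) (elemTransp j) v = v.val + 1) := by
  have h1 : (predPos j).val = j.val - 1 := rfl
  rw [rightAct_elemTransp]
  by_cases h : v = predPos j
  · left
    rw [h, Equiv.swap_apply_left]
    unfold rhoVec
    omega
  · by_cases h' : v = j
    · right; left
      rw [h', Equiv.swap_apply_right]
      unfold rhoVec
      omega
    · right; right
      rw [Equiv.swap_apply_of_ne_of_ne h h']
      exact ⟨fun e => h (Fin.ext (by omega)), fun e => h' (Fin.ext e), rfl⟩

theorem rightAct_rhoVec_signFlip (hn : 2 ≤ n) (v : Fin n) :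
    (v.val = 0 ∧ rightAct (rhoVec n) (signFlip hn) v = -1) ∨
    (v.val ≠ 0 ∧ rightAct (rhoVec n) (signFlip hn) v = v.val + 1) := by
  rw [rightAct_signFlip]
  by_cases h : v = firstPos hn
  · left; rw [if_pos h, h]; simp [firstPos, rhoVec]
  · right; rw [if_neg h]; exact ⟨fun e => h (Fin.ext e), rfl⟩

theorem rightAct_rhoVec_signSwap (hn : 2 ≤ n) (v : Fin n) :
    (v.val = 0 ∧ rightAct (rhoVec n) (signSwap hn) v = -2) ∨
    (v.val = 1 ∧ rightAct (rhoVec n) (signSwap hn) v = -1) ∨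
    (2 ≤ v.val ∧ rightAct (rhoVec n) (signSwap hn) v = v.val + 1) := by
  rw [rightAct_signSwap]
  by_cases h : v = firstPos hn
  · left; rw [if_pos h, h]; simp [firstPos, secondPos, rhoVec]
  · rw [if_neg h]
    by_cases h' : v = secondPos hn
    · right; left; rw [if_pos h', h']; simp [firstPos, secondPos, rhoVec]
    · right; right; rw [if_neg h']
      refine ⟨?_, rfl⟩
      by_contra hv
      have h1 : v.val ≠ 0 := fun e => h (Fin.ext e)
      have h2 : v.val ≠ 1 := fun e => h' (Fin.ext e)
      omega

theorem genB_zero (hn : 2 ≤ n) {i : Fin n} (hi : i.val = 0) : genB hn i = signFlip hn :=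
  if_pos hi

theorem genB_ne_zero (hn : 2 ≤ n) {i : Fin n} (hi : i.val ≠ 0) : genB hn i = elemTransp i :=
  if_neg hi

theorem coe_genD_zero (hn : 2 ≤ n) {i : Fin n} (hi : i.val = 0) :
    (genD hn i : SignedPerm n) = signSwap hn := by
  rw [genD, if_pos hi]

theorem coe_genD_ne_zero (hn : 2 ≤ n) {i : Fin n} (hi : i.val ≠ 0) :
    (genD hn i : SignedPerm n) = elemTransp i := by
  rw [genD, if_neg hi]

theorem rightAct_genB {G : Type*} [AddCommGroup G] (hn : 2 ≤ n) (i : Fin n) (x : Fin n → G) :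
    rightAct x (genB hn i) = x - fun k => corootB i k • linForm (rootB i) x := by
  rw [linForm_rootB]
  unfold corootB
  by_cases hi : i.val = 0
  · rw [genB_zero hn hi, eq_firstPos hn hi]
    funext k
    rw [rightAct_signFlip]
    simp only [Pi.sub_apply]
    by_cases hk : k = firstPos hn
    · subst hk
      simp [firstPos, two_smul]
    · rw [if_neg hk]
      simp [firstPos, Pi.single_eq_of_ne (show k ≠ ⟨0, by omega⟩ from hk)]
  · simp only [if_neg hi]
    rw [genB_ne_zero hn hi]
    exact rightAct_elemTransp_eq_sub hi x

theorem rightAct_genD {G : Type*} [AddCommGroup G] (hn : 2 ≤ n) (i : Fin n) (x : Fin n → G) :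
    rightAct x (genD hn i : SignedPerm n) =
      x - fun k => rootD hn i k • linForm (rootD hn i) x := by
  rw [linForm_rootD]
  unfold rootD
  have hne := firstPos_ne_secondPos hn
  by_cases hi : i.val = 0
  · simp only [if_pos hi]
    rw [coe_genD_zero hn hi]
    funext k
    rw [rightAct_signSwap]
    simp only [Pi.sub_apply, Pi.add_apply]
    by_cases hk : k = firstPos hn
    · rw [if_pos hk, hk, Pi.single_eq_same, Pi.single_eq_of_ne hne]
      simp
    · rw [if_neg hk, Pi.single_eq_of_ne hk]
      by_cases hk' : k = secondPos hn
      · rw [if_pos hk', hk', Pi.single_eq_same]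
        simp
      · rw [if_neg hk', Pi.single_eq_of_ne hk']
        simp
  · simp only [if_neg hi]
    rw [coe_genD_ne_zero hn hi]
    exact rightAct_elemTransp_eq_sub hi x

theorem linForm_rootB_word (w : SignedPerm n) (i : Fin n) :
    linForm (rootB i) (rightAct (rhoVec n) w) ≠ 0 := by
  rw [linForm_rootB]
  split_ifs with hi
  · rw [rightAct_eq]
    rcases coe_unit_eq (w.left (w.right i)) with h | h <;> rw [h] <;>
      simp only [rhoVec, smul_eq_mul] <;> omega
  · rw [rightAct_eq, rightAct_eq, sub_eq_add_neg, smul_eq_mul, smul_eq_mul, ← neg_mul]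
    refine sign_combination_ne (fun h => predPos_ne hi (w.right.injective h).symm)
      (coe_unit_eq _) ?_
    rcases coe_unit_eq (w.left (w.right (predPos i))) with h | h <;> simp [h]

theorem linForm_rootD_word (hn : 2 ≤ n) (w : SignedPerm n) (i : Fin n) :
    linForm (rootD hn i) (rightAct (rhoVec n) w) ≠ 0 := by
  rw [linForm_rootD]
  split_ifs with hi
  · exact sign_combination_ne
      (fun h => firstPos_ne_secondPos hn (w.right.injective h)) (coe_unit_eq _) (coe_unit_eq _)
  · have := linForm_rootB_word w i
    rwa [linForm_rootB, if_neg hi] at this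

/-! ### Coherence and triviality of dominant elements in types B and D -/

theorem diff_word_coherent {G : Type*} [AddCommGroup G] [LinearOrder G] [IsOrderedAddMonoid G]
    (w : SignedPerm n) {i : Fin n} (hi : i.val ≠ 0) {x : Fin n → G} (hx : Monotone x)
    (hx' : ∀ a b, a ≠ b → 0 ≤ x a + x b)
    (h : rightAct (rhoVec n) w i - rightAct (rhoVec n) w (predPos i) < 0) :
    rightAct x w i - rightAct x w (predPos i) ≤ 0 := by
  rw [rightAct_eq, rightAct_eq, sub_eq_add_neg, ← neg_smul] at h ⊢
  refine smul_add_smul_nonpos hx hx' (fun h => predPos_ne hi (w.right.injective h).symm)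
    (coe_unit_eq _) ?_ h
  rcases coe_unit_eq (w.left (w.right (predPos i))) with h | h <;> simp [h]

theorem rootB_coherent {G : Type*} [AddCommGroup G] [LinearOrder G] [IsOrderedAddMonoid G]
    (hn : 2 ≤ n) (w : SignedPerm n) (i : Fin n) (x : Fin n → G)
    (hx : ∀ j, 0 ≤ linForm (rootB j) x)
    (h : linForm (rootB i) (rightAct (rhoVec n) w) < 0) :
    linForm (rootB i) (rightAct x w) ≤ 0 := by
  have hm : Monotone x := monotone_of_predPos_le fun k hk => by
    have := hx k
    rwa [linForm_rootB, if_neg hk, sub_nonneg] at this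
  have h0 : ∀ a, 0 ≤ x a := fun a => by
    have := hx (firstPos hn)
    rw [linForm_rootB, if_pos (firstPos_val hn)] at this
    exact this.trans (hm (Fin.le_def.mpr (Nat.zero_le _)))
  rw [linForm_rootB] at h ⊢
  split_ifs at h ⊢ with hi
  · rw [rightAct_eq] at h ⊢
    rcases coe_unit_eq (w.left (w.right i)) with he | he <;> rw [he] at h ⊢
    · simp only [rhoVec, smul_eq_mul] at h
      omega
    · simpa using h0 _
  · exact diff_word_coherent w hi hm (fun a b _ => add_nonneg (h0 a) (h0 b)) h

theorem rootD_coherent {G : Type*} [AddCommGroup G] [LinearOrder G] [IsOrderedAddMonoid G]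
    (hn : 2 ≤ n) (w : SignedPerm n) (i : Fin n) (x : Fin n → G)
    (hx : ∀ j, 0 ≤ linForm (rootD hn j) x)
    (h : linForm (rootD hn i) (rightAct (rhoVec n) w) < 0) :
    linForm (rootD hn i) (rightAct x w) ≤ 0 := by
  have hm : Monotone x := monotone_of_predPos_le fun k hk => by
    have := hx k
    rwa [linForm_rootD, if_neg hk, sub_nonneg] at this
  have h1 := hx (firstPos hn)
  rw [linForm_rootD, if_pos (firstPos_val hn)] at h1
  have hlt : ∀ a b : Fin n, a < b → 0 ≤ x a + x b := fun a b hab =>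
    h1.trans (add_le_add (hm (Fin.le_def.mpr (Nat.zero_le _)))
      (hm (Fin.le_def.mpr (by simp only [secondPos]; rw [Fin.lt_def] at hab; omega))))
  have h0 : ∀ a b, a ≠ b → 0 ≤ x a + x b := fun a b hab => by
    rcases lt_or_gt_of_ne hab with h2 | h2
    · exact hlt a b h2
    · rw [add_comm]; exact hlt b a h2
  rw [linForm_rootD] at h ⊢
  split_ifs at h ⊢ with hi
  · exact smul_add_smul_nonpos hm h0
      (fun h => firstPos_ne_secondPos hn (w.right.injective h)) (coe_unit_eq _) (coe_unit_eq _) h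
  · exact diff_word_coherent w hi hm h0 h

theorem eq_one_of_rootB (hn : 2 ≤ n) (w : SignedPerm n)
    (h : ∀ i, 0 ≤ linForm (rootB i) (rightAct (rhoVec n) w)) : w = 1 := by
  have h1 : ∀ k : Fin n, k.val ≠ 0 →
      rightAct (rhoVec n) w (predPos k) ≤ rightAct (rhoVec n) w k := fun k hk => by
    have := h k
    rwa [linForm_rootB, if_neg hk, sub_nonneg] at this
  have h0 := h (firstPos hn)
  rw [linForm_rootB, if_pos (firstPos_val hn)] at h0
  have h2 : rightAct (rhoVec n) w (firstPos hn) ≤ rightAct (rhoVec n) w (secondPos hn) :=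
    h1 (secondPos hn) (by simp [secondPos])
  obtain ⟨hr, hl⟩ := right_eq_one_of_word hn h1 (by omega)
  refine SemidirectProduct.ext (funext fun k => ?_) hr
  by_cases hk : k.val = 0
  · rw [eq_firstPos hn hk]
    refine (Int.units_eq_one_or _).resolve_right fun h4 => ?_
    rw [rightAct_eq, hr, Equiv.Perm.one_apply, h4] at h0
    simp only [rhoVec, Units.val_neg, Units.val_one, smul_eq_mul] at h0
    omega
  · exact hl k hk

theorem eq_one_of_rootD (hn : 2 ≤ n) (w : evenSigned n)
    (h : ∀ i, 0 ≤ linForm (rootD hn i) (rightAct (rhoVec n) w)) : w = 1 := by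
  have h1 : ∀ k : Fin n, k.val ≠ 0 →
      rightAct (rhoVec n) w (predPos k) ≤ rightAct (rhoVec n) w k := fun k hk => by
    have := h k
    rwa [linForm_rootD, if_neg hk, sub_nonneg] at this
  have h0 := h (firstPos hn)
  rw [linForm_rootD, if_pos (firstPos_val hn)] at h0
  obtain ⟨hr, hl⟩ := right_eq_one_of_word hn h1 h0
  refine Subtype.ext (SemidirectProduct.ext (funext fun k => ?_) hr)
  by_cases hk : k.val = 0
  · have hp := (even_numSigns_iff _).mp w.2
    rw [Fintype.prod_eq_single k fun j hj => hl j fun hj0 => hj (Fin.ext (hj0.trans hk.symm))]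
      at hp
    exact hp
  · exact hl k hk

theorem right_val_ne {w : SignedPerm n} {a b : Fin n} (h : a ≠ b) :
    (w.right a).val ≠ (w.right b).val :=
  fun e => h (w.right.injective (Fin.ext e))

/-- The letters `1, …, n` relabelled by one of the generators. -/
def IsRelabelling (r : Fin n → ℤ) : Prop :=
  (∃ j : ℕ, ∀ v : Fin n, (v.val + 1 = j ∧ r v = v.val + 2) ∨ (v.val = j ∧ r v = v.val) ∨
    (v.val + 1 ≠ j ∧ v.val ≠ j ∧ r v = v.val + 1)) ∨
  (∀ v : Fin n, (v.val = 0 ∧ r v = -2) ∨ (v.val = 1 ∧ r v = -1) ∨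
    (2 ≤ v.val ∧ r v = v.val + 1))

theorem isRelabelling_elemTransp {j : Fin n} (hj : j.val ≠ 0) :
    IsRelabelling (rightAct (rhoVec n) (elemTransp j)) :=
  Or.inl ⟨j.val, rightAct_rhoVec_elemTransp hj⟩

theorem isRelabelling_signSwap (hn : 2 ≤ n) :
    IsRelabelling (rightAct (rhoVec n) (signSwap hn)) :=
  Or.inr (rightAct_rhoVec_signSwap hn)

/-- If a combination of two entries of a word changes its sign under a relabelling, then the
relabelling exchanges these entries, up to signs, and fixes the other ones. -/
theorem IsRelabelling.exchange {r : Fin n → ℤ} (hr : IsRelabelling r) {a b : Fin n}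
    (hab : a.val ≠ b.val) {e f : ℤ} (he : e = 1 ∨ e = -1) (hf : f = 1 ∨ f = -1)
    (h1 : 0 < e * rhoVec n a + f * rhoVec n b) (h2 : e * r a + f * r b < 0) :
    e * r a = -(f * rhoVec n b) ∧ f * r b = -(e * rhoVec n a) ∧
      ∀ c : Fin n, c.val ≠ a.val → c.val ≠ b.val → r c = rhoVec n c := by
  unfold rhoVec at *
  have key : (e * r a = -(f * (b.val + 1)) ∧ f * r b = -(e * (a.val + 1))) ∧
      ∀ c : Fin n, c.val ≠ a.val → c.val ≠ b.val → r c = c.val + 1 := by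
    rcases hr with ⟨j, hR⟩ | hR
    all_goals
      have r1 := hR a
      have r2 := hR b
      refine ⟨?_, fun c e1 e2 => ?_⟩
      · rcases he with rfl | rfl <;> rcases hf with rfl | rfl <;> omega
      · have r3 := hR c
        rcases he with rfl | rfl <;> rcases hf with rfl | rfl <;> omega
  exact ⟨key.1.1, key.1.2, key.2⟩

theorem IsRelabelling.rightAct_elemTransp {r : Fin n → ℤ} (hr : IsRelabelling r)
    (w : SignedPerm n) {i : Fin n} (hi : i.val ≠ 0)
    (h1 : 0 < rightAct (rhoVec n) w i - rightAct (rhoVec n) w (predPos i))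
    (h2 : rightAct r w i - rightAct r w (predPos i) < 0) :
    rightAct r w = rightAct (rightAct (rhoVec n) w) (elemTransp i) := by
  have hne := predPos_ne hi
  simp only [rightAct_eq, smul_eq_mul, sub_eq_add_neg, ← neg_mul] at h1 h2
  obtain ⟨ha, hb, hc⟩ := hr.exchange (right_val_ne (w := w) hne.symm) (coe_unit_eq _)
    (by rcases coe_unit_eq (w.left (w.right (predPos i))) with h | h <;> simp [h]) h1 h2
  funext k
  rw [_root_.rightAct_elemTransp, rightAct_eq, rightAct_eq, smul_eq_mul, smul_eq_mul]
  by_cases hk : k = i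
  · rw [hk, Equiv.swap_apply_right, ha, neg_mul, neg_neg]
  · by_cases hk' : k = predPos i
    · rw [hk', Equiv.swap_apply_left]
      rw [neg_mul] at hb
      exact neg_injective hb
    · rw [Equiv.swap_apply_of_ne_of_ne hk' hk, hc _ (right_val_ne hk) (right_val_ne hk')]

theorem IsRelabelling.rightAct_signSwap {r : Fin n → ℤ} (hr : IsRelabelling r) (hn : 2 ≤ n)
    (w : SignedPerm n)
    (h1 : 0 < rightAct (rhoVec n) w (firstPos hn) + rightAct (rhoVec n) w (secondPos hn))
    (h2 : rightAct r w (firstPos hn) + rightAct r w (secondPos hn) < 0) :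
    rightAct r w = rightAct (rightAct (rhoVec n) w) (signSwap hn) := by
  simp only [rightAct_eq, smul_eq_mul] at h1 h2
  obtain ⟨ha, hb, hc⟩ := hr.exchange (right_val_ne (w := w) (firstPos_ne_secondPos hn))
    (coe_unit_eq _) (coe_unit_eq _) h1 h2
  funext k
  rw [_root_.rightAct_signSwap]
  simp only [rightAct_eq, smul_eq_mul]
  split_ifs with hk hk'
  · rw [hk, ha]
  · rw [hk', hb]
  · rw [hc _ (right_val_ne hk) (right_val_ne hk')]

/-! ### The exchange property in types B and D -/

theorem exchangeB (hn : 2 ≤ n) (w : SignedPerm n) (i j : Fin n)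
    (h1 : 0 < linForm (rootB i) (rightAct (rhoVec n) w))
    (h2 : linForm (rootB i) (rightAct (rhoVec n) (genB hn j * w)) < 0) :
    genB hn j * w = w * genB hn i := by
  apply rightAct_rhoVec_injective
  rw [linForm_rootB] at h1 h2
  rw [rightAct_mul] at h2 ⊢
  rw [rightAct_mul]
  by_cases hi : i.val = 0
  · rw [if_pos hi] at h1 h2
    rw [genB_zero hn hi]
    rw [rightAct_eq, smul_eq_mul] at h1 h2
    by_cases hj : j.val = 0
    · rw [genB_zero hn hj] at h2 ⊢
      have hR := rightAct_rhoVec_signFlip hn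
      generalize rightAct (rhoVec n) (signFlip hn) = r at *
      have r1 := hR (w.right i)
      -- Only the letter 1 changes sign under s₀, so it must be the first entry of the word.
      have hw : (w.right i).val = 0 := by
        unfold rhoVec at h1
        rcases coe_unit_eq (w.left (w.right i)) with he | he <;> rw [he] at h1 h2 <;> omega
      funext k
      rw [rightAct_signFlip, rightAct_eq, rightAct_eq, smul_eq_mul, smul_eq_mul]
      rw [← eq_firstPos hn hi]
      have r2 := hR (w.right k)
      split_ifs with hk
      · rw [hk]
        have : r (w.right i) = -rhoVec n (w.right i) := by unfold rhoVec; omega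
        rw [this, mul_neg]
      · have := right_val_ne (w := w) hk
        have : r (w.right k) = rhoVec n (w.right k) := by unfold rhoVec; omega
        rw [this]
    · rw [genB_ne_zero hn hj] at h2
      have r1 := rightAct_rhoVec_elemTransp hj (w.right i)
      unfold rhoVec at h1
      rcases coe_unit_eq (w.left (w.right i)) with he | he <;> rw [he] at h1 h2 <;> omega
  · rw [if_neg hi] at h1 h2
    rw [genB_ne_zero hn hi]
    by_cases hj : j.val = 0
    -- Impossible case: negating the letter of least absolute value cannot reverse its comparison
    -- with another entry.
    · rw [genB_zero hn hj] at h2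
      have hR := rightAct_rhoVec_signFlip hn
      generalize rightAct (rhoVec n) (signFlip hn) = r at *
      have r1 := hR (w.right i)
      have r2 := hR (w.right (predPos i))
      have hne := right_val_ne (w := w) (predPos_ne hi)
      simp only [rightAct_eq, smul_eq_mul, rhoVec] at h1 h2
      rcases coe_unit_eq (w.left (w.right i)) with he | he <;>
        rcases coe_unit_eq (w.left (w.right (predPos i))) with hf | hf <;>
        rw [he, hf] at h1 h2 <;> omega
    · rw [genB_ne_zero hn hj] at h2 ⊢
      exact (isRelabelling_elemTransp hj).rightAct_elemTransp w hi h1 h2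

theorem exchangeD (hn : 2 ≤ n) (w : evenSigned n) (i j : Fin n)
    (h1 : 0 < linForm (rootD hn i) (rightAct (rhoVec n) w))
    (h2 : linForm (rootD hn i) (rightAct (rhoVec n) (genD hn j * w : evenSigned n)) < 0) :
    genD hn j * w = w * genD hn i := by
  apply Subtype.ext
  apply rightAct_rhoVec_injective
  rw [Subgroup.coe_mul] at h2 ⊢
  rw [Subgroup.coe_mul]
  rw [linForm_rootD] at h1 h2
  rw [rightAct_mul] at h2 ⊢
  rw [rightAct_mul]
  have hr : IsRelabelling (rightAct (rhoVec n) (genD hn j : SignedPerm n)) := by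
    by_cases hj : j.val = 0
    · rw [coe_genD_zero hn hj]; exact isRelabelling_signSwap hn
    · rw [coe_genD_ne_zero hn hj]; exact isRelabelling_elemTransp hj
  by_cases hi : i.val = 0
  · rw [if_pos hi] at h1 h2
    rw [coe_genD_zero hn hi]
    exact hr.rightAct_signSwap hn w h1 h2
  · rw [if_neg hi] at h1 h2
    rw [coe_genD_ne_zero hn hi]
    exact hr.rightAct_elemTransp w hi h1 h2

/-- A tuple with prescribed first entry and prescribed differences. -/
theorem exists_tuple_diff (b : ℤ) (c : Fin n → ℤ) :
    ∃ x : Fin n → ℤ, (∀ i, i.val = 0 → x i = b) ∧ ∀ i, i.val ≠ 0 → x i - x (predPos i) = c i := by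
  refine ⟨fun i => b + ∑ l ∈ range i.val, if h : l + 1 < n then c ⟨l + 1, h⟩ else 0,
    fun i hi => by simp [hi], fun ⟨i, hi⟩ h0 => ?_⟩
  obtain ⟨m, rfl⟩ : ∃ m, i = m + 1 := Nat.exists_eq_succ_of_ne_zero h0
  simp [predPos, sum_range_succ, hi]

theorem exists_dominantB (hn : 2 ≤ n) (J : Finset (Fin n)) : ∃ x : Fin n → ℤ,
    ∀ i, 0 ≤ linForm (rootB i) x ∧ (linForm (rootB i) x = 0 ↔ i ∈ J) := by
  obtain ⟨x, h0, h1⟩ := exists_tuple_diff (if firstPos hn ∈ J then 0 else 1)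
    fun i => if i ∈ J then 0 else 1
  refine ⟨x, fun i => ?_⟩
  have h : linForm (rootB i) x = if i ∈ J then 0 else 1 := by
    rw [linForm_rootB]
    split_ifs with hi hJ hJ
    · rw [h0 i hi, if_pos (eq_firstPos hn hi ▸ hJ)]
    · rw [h0 i hi, if_neg (eq_firstPos hn hi ▸ hJ)]
    · rw [h1 i hi, if_pos hJ]
    · rw [h1 i hi, if_neg hJ]
  rw [h]
  split_ifs with hJ <;> simp [hJ]

theorem exists_dominantD (hn : 2 ≤ n) (J : Finset (Fin n)) : ∃ x : Fin n → ℤ,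
    ∀ i, 0 ≤ linForm (rootD hn i) x ∧ (linForm (rootD hn i) x = 0 ↔ i ∈ J) := by
  -- Since x₁ + x₂ = 2x₁ + (x₂ − x₁), root values in {0, 2} rather than {0, 1} keep x₁ = `b` an
  -- integer.
  let c : Fin n → ℤ := fun i => if i ∈ J then 0 else 2
  let b : ℤ := (if firstPos hn ∈ J then 0 else 1) - if secondPos hn ∈ J then 0 else 1
  obtain ⟨x, h0, h1⟩ := exists_tuple_diff b c
  refine ⟨x, fun i => ?_⟩
  have h : linForm (rootD hn i) x = c i := by
    rw [linForm_rootD]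
    split_ifs with hi
    · have e0 := h0 (firstPos hn) rfl
      have e1 := h1 (secondPos hn) one_ne_zero
      have e2 : predPos (secondPos hn) = firstPos hn := rfl
      rw [e2] at e1
      rw [eq_firstPos hn hi]
      simp only [b, c] at e0 e1 ⊢
      split_ifs at e0 e1 ⊢ <;> omega
    · exact h1 i hi
  rw [h]
  simp only [c]
  split_ifs with hJ <;> simp [hJ]

theorem linForm_diffRoot {i : Fin n} (hi : i.val ≠ 0) :
    linForm (diffRoot i) (diffRoot i) = 2 ∧ linForm (diffRoot i) (rhoVec n) = 1 := by
  have hne := predPos_ne hi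
  have h : (predPos i).val = i.val - 1 := rfl
  constructor
  · refine (linForm_single_sub_single i _).trans ?_
    simp [diffRoot, Pi.single_eq_of_ne hne, Pi.single_eq_of_ne hne.symm]
  · refine (linForm_single_sub_single i _).trans ?_
    simp only [rhoVec]
    omega

theorem linForm_rootB_corootB (i : Fin n) : linForm (rootB i) (corootB i) = 2 := by
  by_cases hi : i.val = 0
  · rw [linForm_rootB, corootB, if_pos hi, if_pos hi, Pi.single_eq_same]
  · rw [rootB, corootB, if_neg hi, if_neg hi]
    exact (linForm_diffRoot hi).1

theorem linForm_rootD_self (hn : 2 ≤ n) (i : Fin n) :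
    linForm (rootD hn i) (rootD hn i) = 2 := by
  have hne := firstPos_ne_secondPos hn
  by_cases hi : i.val = 0
  · rw [linForm_rootD, if_pos hi, rootD, if_pos hi]
    simp [Pi.single_eq_of_ne hne, Pi.single_eq_of_ne hne.symm]
  · rw [rootD, if_neg hi]
    exact (linForm_diffRoot hi).1

theorem linForm_rootB_rhoVec (i : Fin n) : 0 < linForm (rootB i) (rhoVec n) := by
  by_cases hi : i.val = 0
  · rw [linForm_rootB, if_pos hi]; unfold rhoVec; omega
  · rw [rootB, if_neg hi, (linForm_diffRoot hi).2]; exact one_pos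

theorem linForm_rootD_rhoVec (hn : 2 ≤ n) (i : Fin n) :
    0 < linForm (rootD hn i) (rhoVec n) := by
  by_cases hi : i.val = 0
  · rw [linForm_rootD, if_pos hi]; unfold rhoVec; omega
  · rw [rootD, if_neg hi, (linForm_diffRoot hi).2]; exact one_pos

theorem linForm_corootB_rhoVec (i : Fin n) : 0 < linForm (corootB i) (rhoVec n) := by
  by_cases hi : i.val = 0
  · rw [corootB, if_pos hi]
    simp [linForm, Pi.single_apply, rhoVec]
  · rw [corootB, if_neg hi, (linForm_diffRoot hi).2]; exact one_pos

/-- The reflection frame of `B_n`. -/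
def frameB (hn : 2 ≤ n) : ReflectionFrame (genB hn) n where
  toSigned := MonoidHom.id _
  root := rootB
  coroot := corootB
  rho := rhoVec n
  act_gen i _ _ x := rightAct_genB hn i x
  root_coroot := linForm_rootB_corootB
  rho_coroot i := linForm_comm _ _ ▸ linForm_corootB_rhoVec i
  root_rho := linForm_rootB_rhoVec
  root_rho_act_ne := linForm_rootB_word
  coherent w i _ _ _ _ x := rootB_coherent hn w i x
  eq_one := eq_one_of_rootB hn
  exchange := exchangeB hn
  exists_dominant := exists_dominantB hn

/-- The reflection frame of `D_n`. -/
def frameD (hn : 2 ≤ n) : ReflectionFrame (genD hn) n where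
  toSigned := (evenSigned n).subtype
  root := rootD hn
  coroot := rootD hn
  rho := rhoVec n
  act_gen i _ _ x := rightAct_genD hn i x
  root_coroot := linForm_rootD_self hn
  rho_coroot i := linForm_comm _ _ ▸ linForm_rootD_rhoVec hn i
  root_rho := linForm_rootD_rhoVec hn
  root_rho_act_ne w := linForm_rootD_word hn w
  coherent w i _ _ _ _ x := rootD_coherent hn w i x
  eq_one := eq_one_of_rootD hn
  exchange := exchangeD hn
  exists_dominant := exists_dominantD hn

end Frames

/-! ### The map from `B_n` to `D_n` -/

theorem coeff_basisY {W ι : Type*} [Group W] [Fintype W] [Fintype ι] (s : ι → W) (J : Finset ι)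
    (w : W) [Decidable (desSet s w = J)] :
    (basisY s J).coeff w = if desSet s w = J then 1 else 0 := by
  classical
  unfold basisY
  rw [MonoidAlgebra.coeff_sum, Finsupp.finsetSum_apply]
  simp [Finsupp.single_apply]

theorem coeff_basisX {W ι : Type*} [Group W] [Fintype W] [Fintype ι] (s : ι → W) (J : Finset ι)
    (w : W) [Decidable (desSet s w ⊆ J)] :
    (basisX s J).coeff w = if desSet s w ⊆ J then 1 else 0 := by
  classical
  unfold basisX
  rw [MonoidAlgebra.coeff_sum, Finsupp.finsetSum_apply]
  simp_rw [coeff_basisY]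
  rw [sum_ite_eq]
  simp

/-! ### Fibres of χ and the descents on them -/

section Chi

variable {n : ℕ} (hn : 2 ≤ n)

theorem mem_evenSigned_iff {w : SignedPerm n} : w ∈ evenSigned n ↔ ∏ v, w.left v = 1 :=
  even_numSigns_iff w

theorem mul_mem_evenSigned_of_notMem {u w : SignedPerm n} (hu : u ∉ evenSigned n)
    (hw : w ∉ evenSigned n) : u * w ∈ evenSigned n := by
  rw [mem_evenSigned_iff] at *
  rw [prod_left_mul, (Int.units_eq_one_or _).resolve_left hu,
    (Int.units_eq_one_or _).resolve_left hw]
  simp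

theorem signFlip_notMem : signFlip hn ∉ evenSigned n := by
  rw [mem_evenSigned_iff, prod_left_signFlip]
  decide

theorem signFlip_mul_self : signFlip hn * signFlip hn = 1 := by
  have := (frameB hn).gen_mul_self (firstPos hn)
  rwa [genB_zero hn (firstPos_val hn)] at this

theorem mul_signFlip_mul_signFlip (w : SignedPerm n) : w * signFlip hn * signFlip hn = w := by
  rw [mul_assoc, signFlip_mul_self, mul_one]

theorem mul_signFlip_notMem {v : SignedPerm n} (hv : v ∈ evenSigned n) :
    v * signFlip hn ∉ evenSigned n := by
  rw [Subgroup.mul_mem_cancel_left _ hv]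
  exact signFlip_notMem hn

theorem coe_chi_of_mem {w : SignedPerm n} (hw : w ∈ evenSigned n) :
    (chi hn w : SignedPerm n) = w := by
  rw [chi, dif_pos hw]

theorem coe_chi_of_notMem {w : SignedPerm n} (hw : w ∉ evenSigned n) :
    (chi hn w : SignedPerm n) = w * signFlip hn := by
  rw [chi, dif_neg hw]

theorem chi_eq_iff {w : SignedPerm n} {v : evenSigned n} :
    chi hn w = v ↔ w = v ∨ w = v * signFlip hn := by
  rw [← Subtype.coe_inj]
  by_cases hw : w ∈ evenSigned n
  · rw [coe_chi_of_mem hn hw]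
    refine ⟨Or.inl, fun h => h.resolve_right ?_⟩
    rintro rfl
    exact mul_signFlip_notMem hn v.2 hw
  · rw [coe_chi_of_notMem hn hw]
    constructor
    · intro h
      right
      rw [← h, mul_signFlip_mul_signFlip]
    · rintro (rfl | rfl)
      · exact absurd v.2 hw
      · exact mul_signFlip_mul_signFlip hn _

theorem coeff_chiLin (x : MonoidAlgebra ℚ (SignedPerm n)) (v : evenSigned n) :
    (chiLin hn x).coeff v = x.coeff v + x.coeff (v * signFlip hn) := by
  classical
  induction x using MonoidAlgebra.induction_linear with
  | zero => simp
  | add x y hx hy =>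
    rw [map_add]
    simp only [MonoidAlgebra.coeff_add, Finsupp.add_apply, hx, hy]
    ring
  | single w r =>
    have hne : ¬ (w = v ∧ w = v * signFlip hn) := fun h =>
      mul_signFlip_notMem hn v.2 (h.2 ▸ h.1 ▸ v.2)
    rw [chiLin, MonoidAlgebra.mapDomainLinearMap_single]
    simp only [MonoidAlgebra.coeff_single, Finsupp.single_apply, chi_eq_iff]
    by_cases h1 : w = v <;> by_cases h2 : w = v * signFlip hn
    · exact absurd ⟨h1, h2⟩ hne
    · rw [if_pos (Or.inl h1), if_pos h1, if_neg h2, add_zero]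
    · rw [if_pos (Or.inr h2), if_neg h1, if_pos h2, zero_add]
    · rw [if_neg (not_or.mpr ⟨h1, h2⟩), if_neg h1, if_neg h2, add_zero]

theorem mem_desSet_genB (w : SignedPerm n) (i : Fin n) : i ∈ desSet (genB hn) w ↔
    if i.val = 0 then rightAct (rhoVec n) w i < 0
      else rightAct (rhoVec n) w i < rightAct (rhoVec n) w (predPos i) := by
  rw [(frameB hn).mem_desSet]
  change linForm (rootB i) (rightAct (rhoVec n) w) < 0 ↔ _
  rw [linForm_rootB]
  split_ifs
  · rfl
  · rw [sub_neg]

theorem mem_desSet_genD (w : evenSigned n) (i : Fin n) : i ∈ desSet (genD hn) w ↔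
    if i.val = 0 then rightAct (rhoVec n) w (firstPos hn) +
        rightAct (rhoVec n) w (secondPos hn) < 0
      else rightAct (rhoVec n) w i < rightAct (rhoVec n) w (predPos i) := by
  rw [(frameD hn).mem_desSet]
  change linForm (rootD hn i) (rightAct (rhoVec n) w) < 0 ↔ _
  rw [linForm_rootD]
  split_ifs
  · rfl
  · rw [sub_neg]

/-- The descents of the two preimages of `v` under `chi`, compared with the descents of `v`. -/
theorem desSet_relations {z o : Fin n} (hz : z.val = 0) (ho : o.val = 1) (v : evenSigned n) :
    (z ∈ desSet (genB hn) (v * signFlip hn) ↔ z ∉ desSet (genB hn) (v : SignedPerm n)) ∧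
    (o ∈ desSet (genB hn) (v : SignedPerm n) ↔ o ∈ desSet (genD hn) v) ∧
    (o ∈ desSet (genB hn) (v * signFlip hn) ↔ z ∈ desSet (genD hn) v) ∧
    (z ∈ desSet (genB hn) (v : SignedPerm n) → o ∈ desSet (genD hn) v →
      z ∈ desSet (genD hn) v) ∧
    (z ∉ desSet (genB hn) (v : SignedPerm n) → z ∈ desSet (genD hn) v →
      o ∈ desSet (genD hn) v) ∧
    ∀ i : Fin n, 2 ≤ i.val →
      ((i ∈ desSet (genB hn) (v : SignedPerm n) ↔ i ∈ desSet (genD hn) v) ∧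
      (i ∈ desSet (genB hn) (v * signFlip hn) ↔ i ∈ desSet (genD hn) v)) := by
  obtain rfl : z = firstPos hn := Fin.ext hz
  obtain rfl : o = secondPos hn := Fin.ext ho
  have h1 : (secondPos hn).val ≠ 0 := one_ne_zero
  have hne := (firstPos_ne_secondPos hn).symm
  have hp : predPos (secondPos hn) = firstPos hn := rfl
  -- The first entry is nonzero, so negating it toggles the descent at 0. The comparison −w₁ > w₂ is
  -- the D-descent condition w₁ + w₂ < 0.
  have hw := linForm_rootB_word (v : SignedPerm n) (firstPos hn)
  rw [linForm_rootB, if_pos (firstPos_val hn)] at hw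
  simp only [mem_desSet_genB, mem_desSet_genD, rightAct_mul, rightAct_signFlip,
    if_pos (firstPos_val hn), if_neg h1, hp, if_neg hne, if_true]
  refine ⟨by omega, trivial, by omega, by omega, by omega, fun i hi => ?_⟩
  have hi0 : i.val ≠ 0 := by omega
  have hi1 : i ≠ firstPos hn := fun h => hi0 (congrArg Fin.val h)
  have hi2 : predPos i ≠ firstPos hn := fun h => by
    have : i.val - 1 = 0 := congrArg Fin.val h
    omega
  simp only [if_neg hi0, if_neg hi1, if_neg hi2, and_self]

/-- If a descent `i` appears or disappears, exchange gives s₀w = w s_i. Comparing parities of signs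
excludes every `i` but 0. -/
theorem desSet_signFlip_mul (w : SignedPerm n) : signFlip hn * w = w * signFlip hn ∨
    desSet (genB hn) (signFlip hn * w) = desSet (genB hn) w := by
  refine or_iff_not_imp_right.mpr fun h => ?_
  have hflip : ∃ i, signFlip hn * w = w * genB hn i := by
    by_contra! hi
    refine h (Finset.ext fun i => ?_)
    rw [(frameB hn).mem_desSet, (frameB hn).mem_desSet]
    have h0 := genB_zero hn (firstPos_val hn)
    constructor
    · intro hd
      by_contra hd'
      refine hi i ?_
      rw [← h0]
      exact (frameB hn).exchange w i (firstPos hn) ((frameB hn).not_desc_iff.mp hd')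
        (by rw [h0]; exact hd)
    · intro hd
      by_contra hd'
      refine hi i ?_
      have := (frameB hn).exchange (signFlip hn * w) i (firstPos hn)
        ((frameB hn).not_desc_iff.mp hd')
        (by rw [h0, ← mul_assoc, signFlip_mul_self, one_mul]; exact hd)
      rw [h0, ← mul_assoc, signFlip_mul_self, one_mul] at this
      conv_rhs => rw [this]
      rw [(frameB hn).mul_gen_mul_gen]
  obtain ⟨i, hi⟩ := hflip
  by_cases hi0 : i.val = 0
  · rwa [genB_zero hn hi0] at hi
  · rw [genB_ne_zero hn hi0] at hi
    have h1 := congrArg (fun w : SignedPerm n => ∏ v, w.left v) hi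
    simp only [prod_left_mul, prod_left_signFlip,
      mem_evenSigned_iff.mp (elemTransp_mem i), mul_one] at h1
    rcases Int.units_eq_one_or (∏ v, w.left v) with h2 | h2 <;> rw [h2] at h1 <;>
      exact absurd h1 (by decide)

/-- Conjugation by the sign flip on `D_n`. -/
def conjFlip (v : evenSigned n) : evenSigned n :=
  ⟨signFlip hn * v * signFlip hn, mul_mem_evenSigned_of_notMem
    (fun h => signFlip_notMem hn ((Subgroup.mul_mem_cancel_right _ v.2).mp h))
    (signFlip_notMem hn)⟩

theorem conjFlip_conjFlip (v : evenSigned n) : conjFlip hn (conjFlip hn v) = v := by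
  apply Subtype.ext
  change signFlip hn * (signFlip hn * v * signFlip hn) * signFlip hn = v
  rw [← mul_assoc, ← mul_assoc, signFlip_mul_self, one_mul, mul_signFlip_mul_signFlip]

/-! ### Multiplicativity of χ up to conjugation by s₀ -/

theorem chi_mul_of_mem {u : SignedPerm n} (hu : u ∈ evenSigned n) (w : SignedPerm n) :
    chi hn (u * w) = chi hn u * chi hn w := by
  apply Subtype.ext
  rw [Subgroup.coe_mul, coe_chi_of_mem hn hu]
  by_cases hw : w ∈ evenSigned n
  · rw [coe_chi_of_mem hn hw, coe_chi_of_mem hn (mul_mem hu hw)]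
  · rw [coe_chi_of_notMem hn hw, coe_chi_of_notMem hn
      (fun h => hw ((Subgroup.mul_mem_cancel_left _ hu).mp h)), mul_assoc]

theorem chi_mul_of_notMem {u : SignedPerm n} (hu : u ∉ evenSigned n) (w : SignedPerm n) :
    chi hn (u * w) = chi hn u * conjFlip hn (chi hn w) := by
  apply Subtype.ext
  rw [Subgroup.coe_mul, coe_chi_of_notMem hn hu]
  change _ = u * signFlip hn * (signFlip hn * (chi hn w) * signFlip hn)
  rw [← mul_assoc, ← mul_assoc, mul_signFlip_mul_signFlip]
  by_cases hw : w ∈ evenSigned n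
  · rw [coe_chi_of_mem hn hw, coe_chi_of_notMem hn
      (fun h => hu ((Subgroup.mul_mem_cancel_right _ hw).mp h))]
  · rw [coe_chi_of_notMem hn hw, coe_chi_of_mem hn (mul_mem_evenSigned_of_notMem hu hw),
      ← mul_assoc, mul_signFlip_mul_signFlip]

/-- The linear extension of conjugation by the sign flip. -/
noncomputable def conjFlipLin :
    MonoidAlgebra ℚ (evenSigned n) →ₗ[ℚ] MonoidAlgebra ℚ (evenSigned n) :=
  MonoidAlgebra.mapDomainLinearMap ℚ ℚ (conjFlip hn)

theorem coeff_conjFlipLin (x : MonoidAlgebra ℚ (evenSigned n)) (v : evenSigned n) :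
    (conjFlipLin hn x).coeff v = x.coeff (conjFlip hn v) := by
  classical
  induction x using MonoidAlgebra.induction_linear with
  | zero => simp
  | add x y hx hy =>
    rw [map_add]
    simp only [MonoidAlgebra.coeff_add, Finsupp.add_apply, hx, hy]
  | single w r =>
    have h : conjFlip hn w = v ↔ w = conjFlip hn v :=
      ⟨fun h => by rw [← h, conjFlip_conjFlip], fun h => by rw [h, conjFlip_conjFlip]⟩
    rw [conjFlipLin, MonoidAlgebra.mapDomainLinearMap_single]
    simp only [MonoidAlgebra.coeff_single, Finsupp.single_apply, h]

open Classical in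
theorem chiLin_single_mul (u : SignedPerm n) (r : ℚ) (y : MonoidAlgebra ℚ (SignedPerm n)) :
    chiLin hn (MonoidAlgebra.single u r * y) = MonoidAlgebra.single (chi hn u) r *
      if u ∈ evenSigned n then chiLin hn y else conjFlipLin hn (chiLin hn y) := by
  induction y using MonoidAlgebra.induction_linear with
  | zero => simp
  | add x y hx hy =>
    rw [mul_add, map_add, hx, hy, ← mul_add]
    split_ifs <;> simp
  | single w q =>
    simp only [chiLin, conjFlipLin, MonoidAlgebra.single_mul_single,
      MonoidAlgebra.mapDomainLinearMap_single]
    split_ifs with hu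
    · rw [MonoidAlgebra.single_mul_single, chi_mul_of_mem hn hu]
    · rw [MonoidAlgebra.single_mul_single, chi_mul_of_notMem hn hu]

/-- The fibres over v and s₀vs₀ are {v, vs₀} and {s₀vs₀, s₀v}. Left multiplication by s₀ matches
them with equal descent sets, unless s₀ commutes with v, when the fibres coincide. -/
theorem conjFlipLin_chiLin {b : MonoidAlgebra ℚ (SignedPerm n)}
    (hb : b ∈ descentSpan (genB hn)) : conjFlipLin hn (chiLin hn b) = chiLin hn b := by
  induction hb using Submodule.span_induction with
  | zero => simp
  | add x y _ _ hx hy => rw [map_add, map_add, hx, hy]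
  | smul c x _ hx => rw [map_smul, map_smul, hx]
  | mem x hx =>
    obtain ⟨K, rfl⟩ := hx
    ext v
    rw [coeff_conjFlipLin, coeff_chiLin, coeff_chiLin]
    have h : ((conjFlip hn v : evenSigned n) : SignedPerm n) =
      signFlip hn * v * signFlip hn := rfl
    rw [h, mul_signFlip_mul_signFlip]
    rcases desSet_signFlip_mul hn v with h1 | h1
    · rw [h1, mul_signFlip_mul_signFlip]
    · rcases desSet_signFlip_mul hn (v * signFlip hn) with h2 | h2
      · rw [← mul_assoc] at h2
        rw [mul_right_cancel h2, mul_signFlip_mul_signFlip]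
      · rw [← mul_assoc] at h2
        classical
        simp only [coeff_basisY, h1, h2]
        exact add_comm _ _

/-- Only the right factor has to absorb the conjugation, so the left one is arbitrary. -/
theorem chiLin_mul (a : MonoidAlgebra ℚ (SignedPerm n)) {b : MonoidAlgebra ℚ (SignedPerm n)}
    (hb : b ∈ descentSpan (genB hn)) : chiLin hn (a * b) = chiLin hn a * chiLin hn b := by
  induction a using MonoidAlgebra.induction_linear with
  | zero => simp
  | add x y hx hy => rw [add_mul, map_add, hx, hy, map_add, add_mul]
  | single u r =>
    rw [chiLin_single_mul, conjFlipLin_chiLin hn hb, ite_self, chiLin,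
      MonoidAlgebra.mapDomainLinearMap_single]

theorem chiLin_one : chiLin hn 1 = 1 := by
  rw [MonoidAlgebra.one_def, chiLin, MonoidAlgebra.mapDomainLinearMap_single]
  congr 1
  exact Subtype.ext (coe_chi_of_mem hn (one_mem _))

end Chi

/-! ### Explicit formulas and the induced morphism -/

section Formulas

variable {n : ℕ}

theorem eq_or_eq_or_two_le {z o : Fin n} (hz : z.val = 0) (ho : o.val = 1) (i : Fin n) :
    i = z ∨ i = o ∨ 2 ≤ i.val := by
  rcases lt_or_ge i.val 2 with h | h
  · rcases Nat.lt_succ_iff.mp h |>.lt_or_eq with h | h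
    · exact Or.inl (Fin.ext (by omega))
    · exact Or.inr (Or.inl (Fin.ext (by omega)))
  · exact Or.inr (Or.inr h)

/-- A set of nodes is determined by its tail and by the membership of the two first nodes. -/
theorem eq_union_iff {z o : Fin n} (hz : z.val = 0) (ho : o.val = 1) {J : Finset (Fin n)}
    (hJ : ∀ j ∈ J, 2 ≤ j.val) {A : Finset (Fin n)} (hA : A ⊆ {z, o}) (D : Finset (Fin n)) :
    D = A ∪ J ↔ (∀ i : Fin n, 2 ≤ i.val → (i ∈ D ↔ i ∈ J)) ∧ (z ∈ D ↔ z ∈ A) ∧ (o ∈ D ↔ o ∈ A) := by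
  have hzJ : z ∉ J := fun h => by have := hJ z h; omega
  have hoJ : o ∉ J := fun h => by have := hJ o h; omega
  have hAi : ∀ i : Fin n, 2 ≤ i.val → i ∉ A := fun i hi h => by
    rcases mem_insert.mp (hA h) with rfl | h
    · omega
    · rw [mem_singleton] at h
      subst h
      omega
  constructor
  · rintro rfl
    refine ⟨fun i hi => ?_, ?_, ?_⟩
    · simp [hAi i hi]
    · simp [hzJ]
    · simp [hoJ]
  · rintro ⟨h1, h2, h3⟩
    ext i
    rcases eq_or_eq_or_two_le hz ho i with rfl | rfl | hi
    · simp [h2, hzJ]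
    · simp [h3, hoJ]
    · simp [h1 i hi, hAi i hi]

theorem subset_union_iff {z o : Fin n} (hz : z.val = 0) (ho : o.val = 1) {J : Finset (Fin n)}
    (hJ : ∀ j ∈ J, 2 ≤ j.val) {A : Finset (Fin n)} (hA : A ⊆ {z, o}) (D : Finset (Fin n)) :
    D ⊆ A ∪ J ↔ (∀ i : Fin n, 2 ≤ i.val → (i ∈ D → i ∈ J)) ∧ (z ∈ D → z ∈ A) ∧ (o ∈ D → o ∈ A) := by
  have hzJ : z ∉ J := fun h => by have := hJ z h; omega
  have hoJ : o ∉ J := fun h => by have := hJ o h; omega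
  have hAi : ∀ i : Fin n, 2 ≤ i.val → i ∉ A := fun i hi h => by
    rcases mem_insert.mp (hA h) with rfl | h
    · omega
    · rw [mem_singleton] at h
      subst h
      omega
  constructor
  · intro h
    refine ⟨fun i hi hD => ?_, fun hD => ?_, fun hD => ?_⟩
    · simpa [hAi i hi] using h hD
    · simpa [hzJ] using h hD
    · simpa [hoJ] using h hD
  · rintro ⟨h1, h2, h3⟩ i hD
    rw [mem_union]
    rcases eq_or_eq_or_two_le hz ho i with rfl | rfl | hi
    · exact Or.inl (h2 hD)
    · exact Or.inl (h3 hD)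
    · exact Or.inr (h1 i hi hD)

theorem chiLin_formulas (hn : 2 ≤ n) {z o : Fin n} (hz : z.val = 0) (ho : o.val = 1)
    {J : Finset (Fin n)} (hJ : ∀ j ∈ J, 2 ≤ j.val) :
    (chiLin hn (basisY (genB hn) J) = basisY (genD hn) J ∧
      chiLin hn (basisY (genB hn) ({o} ∪ J)) =
        basisY (genD hn) ({z} ∪ J) + basisY (genD hn) ({o} ∪ J) +
          basisY (genD hn) ({z, o} ∪ J) ∧
      chiLin hn (basisY (genB hn) ({z} ∪ J)) =
        basisY (genD hn) J + basisY (genD hn) ({z} ∪ J) + basisY (genD hn) ({o} ∪ J) ∧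
      chiLin hn (basisY (genB hn) ({z, o} ∪ J)) = basisY (genD hn) ({z, o} ∪ J)) ∧
    (chiLin hn (basisX (genB hn) J) = basisX (genD hn) J ∧
      chiLin hn (basisX (genB hn) ({o} ∪ J)) = basisX (genD hn) ({z, o} ∪ J) ∧
      chiLin hn (basisX (genB hn) ({z} ∪ J)) =
        basisX (genD hn) ({z} ∪ J) + basisX (genD hn) ({o} ∪ J) ∧
      chiLin hn (basisX (genB hn) ({z, o} ∪ J)) =
        (2 : ℚ) • basisX (genD hn) ({z, o} ∪ J)) := by
  classical
  have hzo : z ≠ o := fun h => by rw [h, ho] at hz; exact one_ne_zero hz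
  have e0 := eq_union_iff hz ho hJ (empty_subset _)
  have e1 := eq_union_iff hz ho hJ (A := {z}) (by simp)
  have e2 := eq_union_iff hz ho hJ (A := {o}) (by simp)
  have e3 := eq_union_iff hz ho hJ (subset_refl _)
  have s0 := subset_union_iff hz ho hJ (empty_subset _)
  have s1 := subset_union_iff hz ho hJ (A := {z}) (by simp)
  have s2 := subset_union_iff hz ho hJ (A := {o}) (by simp)
  have s3 := subset_union_iff hz ho hJ (subset_refl _)
  simp only [empty_union, notMem_empty, mem_singleton, mem_insert, hzo, hzo.symm, or_true,
    iff_true, iff_false, imp_false, imp_true_iff, and_true, or_false]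
    at e0 e1 e2 e3 s0 s1 s2 s3
  refine ⟨⟨?_, ?_, ?_, ?_⟩, ?_, ?_, ?_, ?_⟩
  all_goals
    ext v
    obtain ⟨h1, h2, h3, h4, h5, h6⟩ := desSet_relations hn hz ho v
    -- The tail conditions are the same for v, for v s₀ and in type D. Naming them as opaque
    -- propositions, `T` for equality and `S` for inclusion, reduces each identity to a finite truth
    -- table.
    obtain ⟨T, hT⟩ : ∃ T : Prop, (∀ i : Fin n, 2 ≤ i.val →
      (i ∈ desSet (genD hn) v ↔ i ∈ J)) ↔ T := ⟨_, Iff.rfl⟩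
    obtain ⟨S, hS⟩ : ∃ S : Prop, (∀ i : Fin n, 2 ≤ i.val →
      (i ∈ desSet (genD hn) v → i ∈ J)) ↔ S := ⟨_, Iff.rfl⟩
    have t1 : (∀ i : Fin n, 2 ≤ i.val →
        (i ∈ desSet (genB hn) (v : SignedPerm n) ↔ i ∈ J)) ↔ T :=
      (forall₂_congr fun i hi => by rw [(h6 i hi).1]).trans hT
    have t2 : (∀ i : Fin n, 2 ≤ i.val →
        (i ∈ desSet (genB hn) (v * signFlip hn) ↔ i ∈ J)) ↔ T :=
      (forall₂_congr fun i hi => by rw [(h6 i hi).2]).trans hT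
    have t3 : (∀ i : Fin n, 2 ≤ i.val →
        (i ∈ desSet (genB hn) (v : SignedPerm n) → i ∈ J)) ↔ S :=
      (forall₂_congr fun i hi => by rw [(h6 i hi).1]).trans hS
    have t4 : (∀ i : Fin n, 2 ≤ i.val →
        (i ∈ desSet (genB hn) (v * signFlip hn) → i ∈ J)) ↔ S :=
      (forall₂_congr fun i hi => by rw [(h6 i hi).2]).trans hS
    rw [coeff_chiLin]
    simp only [MonoidAlgebra.coeff_add, MonoidAlgebra.coeff_smul, Finsupp.add_apply,
      Finsupp.smul_apply, coeff_basisY, coeff_basisX, e0, e1, e2, e3, s0, s1, s2, s3,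
      t1, t2, t3, t4, hT, hS, h1, h2, h3]
    clear hT hS t1 t2 t3 t4
    -- The remaining unknowns are the sign of the first entry and the two D-descents at the fork;
    -- `h4` and `h5` rule out the incompatible combinations.
    by_cases hT : T <;> by_cases hS : S <;>
      by_cases a1 : z ∈ desSet (genB hn) (v : SignedPerm n) <;>
      by_cases a2 : z ∈ desSet (genD hn) v <;> by_cases a3 : o ∈ desSet (genD hn) v <;>
      simp only [a1, a2, a3, not_true_eq_false, not_false_eq_true, imp_false, true_implies]
        at h4 h5 <;>
      simp [hT, hS, a1, a2, a3] <;> norm_num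

theorem chiLin_mem_descentSpan (hn : 2 ≤ n) {x : MonoidAlgebra ℚ (SignedPerm n)}
    (hx : x ∈ descentSpan (genB hn)) : chiLin hn x ∈ descentSpan (genD hn) := by
  classical
  have hY : ∀ J, basisY (genD hn) J ∈ descentSpan (genD hn) := fun J =>
    Submodule.subset_span ⟨J, rfl⟩
  induction hx using Submodule.span_induction with
  | zero => simp
  | add x y _ _ hx hy => rw [map_add]; exact Submodule.add_mem _ hx hy
  | smul c x _ hx => rw [map_smul]; exact Submodule.smul_mem _ _ hx
  | mem x hx =>
    obtain ⟨K, rfl⟩ := hx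
    have hz := firstPos_val hn
    have ho : (secondPos hn).val = 1 := rfl
    have hJ : ∀ j ∈ K.filter fun i => 2 ≤ i.val, 2 ≤ j.val := fun j hj => (mem_filter.mp hj).2
    have hK := eq_union_iff hz ho hJ (A := K.filter fun i => i.val < 2)
      (fun i hi => by
        rw [mem_insert, mem_singleton]
        have := (mem_filter.mp hi).2
        rcases eq_or_eq_or_two_le hz ho i with h | h | h
        · exact Or.inl h
        · exact Or.inr h
        · omega) K
    obtain ⟨⟨h0, h1, h2, h3⟩, -⟩ := chiLin_formulas hn hz ho hJ
    have hne := firstPos_ne_secondPos hn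
    have key := fun A hA => (eq_union_iff hz ho hJ (A := A) hA K).mpr
    by_cases a : firstPos hn ∈ K <;> by_cases b : secondPos hn ∈ K
    · rw [key {firstPos hn, secondPos hn} (subset_refl _)
        ⟨fun i hi => by simp [hi], by simp [a], by simp [b]⟩, h3]
      exact hY _
    · rw [key {firstPos hn} (by simp)
        ⟨fun i hi => by simp [hi], by simp [a], by simp [b, hne.symm]⟩, h2]
      exact add_mem (add_mem (hY _) (hY _)) (hY _)
    · rw [key {secondPos hn} (by simp)
        ⟨fun i hi => by simp [hi], by simp [a, hne], by simp [b]⟩, h1]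
      exact add_mem (add_mem (hY _) (hY _)) (hY _)
    · rw [key ∅ (empty_subset _)
        ⟨fun i hi => by simp [hi], by simp [a], by simp [b]⟩, empty_union, h0]
      exact hY _

theorem phi_eq_psi_chi (hn : 2 ≤ n) (w : SignedPerm n) : phi n w = psi n (chi hn w) := by
  change _ = phi n (chi hn w : SignedPerm n)
  by_cases hw : w ∈ evenSigned n
  · rw [coe_chi_of_mem hn hw]
  · rw [coe_chi_of_notMem hn hw, map_mul]
    -- The underlying permutation of s₀ is the identity by definition.
    exact (mul_one _).symm

theorem phiLin_eq_psiLin_chiLin (hn : 2 ≤ n) (x : MonoidAlgebra ℚ (SignedPerm n)) :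
    phiLin n x = psiLin n (chiLin hn x) := by
  induction x using MonoidAlgebra.induction_linear with
  | zero => simp
  | add x y hx hy => simp only [map_add, hx, hy]
  | single w r =>
    rw [chiLin, MonoidAlgebra.mapDomainLinearMap_single]
    simp [phiLin, psiLin, phi_eq_psi_chi hn]

/-- The morphism between the descent algebras induced by `chi`. -/
noncomputable def chiDescentHom (hn : 2 ≤ n) :
    (frameB hn).descentAlgebra →ₐ[ℚ] (frameD hn).descentAlgebra :=
  AlgHom.ofLinearMap
    { toFun := fun x => ⟨chiLin hn x, chiLin_mem_descentSpan hn x.2⟩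
      map_add' := fun _ _ => Subtype.ext (map_add (chiLin hn) _ _)
      map_smul' := fun _ _ => Subtype.ext (map_smul (chiLin hn) _ _) }
    (Subtype.ext (chiLin_one hn))
    (fun x y => Subtype.ext (chiLin_mul hn x y.2))

end Formulas

end DescentAlgebras

/-- Both in type B and in type D the index set of the generators is `Fin n`; the indices `z = 0`
and `o = 1` are the nodes `0` and `1` in type B, and the nodes `1'` and `1` in type D. -/
theorem mainTheorem7 (n : ℕ) (hn : 2 ≤ n) (z o : Fin n) (hz : z.val = 0) (ho : o.val = 1) :
    -- `χ` restricts to a morphism of algebras between the descent algebras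
    (∃ (SB : Subalgebra ℚ (MonoidAlgebra ℚ (SignedPerm n)))
        (SD : Subalgebra ℚ (MonoidAlgebra ℚ (evenSigned n))) (f : SB →ₐ[ℚ] SD),
        Subalgebra.toSubmodule SB = descentSpan (genB hn) ∧
        Subalgebra.toSubmodule SD = descentSpan (genD hn) ∧
        ∀ x : SB, ((f x : SD) : MonoidAlgebra ℚ (evenSigned n)) =
          chiLin hn (x : MonoidAlgebra ℚ (SignedPerm n))) ∧
    -- explicit formulas on the `Y` and `X` bases
    (∀ J : Finset (Fin n), (∀ j ∈ J, 2 ≤ j.val) →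
      (chiLin hn (basisY (genB hn) J) = basisY (genD hn) J ∧
        chiLin hn (basisY (genB hn) ({o} ∪ J)) =
          basisY (genD hn) ({z} ∪ J) + basisY (genD hn) ({o} ∪ J) +
            basisY (genD hn) ({z, o} ∪ J) ∧
        chiLin hn (basisY (genB hn) ({z} ∪ J)) =
          basisY (genD hn) J + basisY (genD hn) ({z} ∪ J) + basisY (genD hn) ({o} ∪ J) ∧
        chiLin hn (basisY (genB hn) ({z, o} ∪ J)) = basisY (genD hn) ({z, o} ∪ J)) ∧
      (chiLin hn (basisX (genB hn) J) = basisX (genD hn) J ∧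
        chiLin hn (basisX (genB hn) ({o} ∪ J)) = basisX (genD hn) ({z, o} ∪ J) ∧
        chiLin hn (basisX (genB hn) ({z} ∪ J)) =
          basisX (genD hn) ({z} ∪ J) + basisX (genD hn) ({o} ∪ J) ∧
        chiLin hn (basisX (genB hn) ({z, o} ∪ J)) =
          (2 : ℚ) • basisX (genD hn) ({z, o} ∪ J))) ∧
    -- `φ = ψ χ`, for the groups and for the group algebras
    (∀ w : SignedPerm n, phi n w = psi n (chi hn w)) ∧
    (∀ x : MonoidAlgebra ℚ (SignedPerm n), phiLin n x = psiLin n (chiLin hn x)) :=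
  ⟨⟨(frameB hn).descentAlgebra, (frameD hn).descentAlgebra, chiDescentHom hn, rfl, rfl,
      fun _ => rfl⟩,
    fun _ hJ => chiLin_formulas hn hz ho hJ, phi_eq_psi_chi hn, phiLin_eq_psiLin_chiLin hn⟩
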